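/- All graphs are finite, simple and undirected, and $\rho(G)$ denotes the spectral radius of $G$, i.e. the largest eigenvalue of its adjacency matrix. Let $C_5^+$ be the graph obtained from a cycle $C_5$ and a triangle $C_3$ by identifying an edge of one with an edge of the other (so it has $6$ vertices and $7$ edges). For $n\ge 4$ let $S_{n,2}$ be the graph obtained by joining each vertex of $K_2$ to each of $n-2$ isolated vertices, and let $S_{n,2}^-$ be the graph obtained from $S_{n,2}$ by deleting one edge incident to a vertex of degree two. Theorem. Let $m\ge 74$ be an even integer, and let $G$ be a graph with exactly $m$ edges and without isolated vertices that does not contain $C_5^+$ as a (not necessarily induced) subgraph. Then $$\rho(G)\le \rho\bigl(S_{\frac{m+4}{2},2}^-\bigr),$$ and equality holds if and only if $G\cong S_{\frac{m+4}{2},2}^-$. -/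

import Mathlib

namespace SpectralTuran

/-- The spectral radius `ρ(G)` of a finite graph: the largest (real) eigenvalue of its adjacency
matrix. The set of eigenvalues is finite, and nonempty as soon as `G` has a vertex; see
`isGreatest_rho`. -/
noncomputable def rho {V : Type*} [Fintype V] (G : SimpleGraph V) : ℝ :=
  open Classical in
  sSup {μ : ℝ | Module.End.HasEigenvalue (Matrix.toLin' (G.adjMatrix ℝ)) μ}

theorem isGreatest_rho {V : Type*} [Fintype V] [DecidableEq V] [Nonempty V] (G : SimpleGraph V)
    [DecidableRel G.Adj] :
    IsGreatest {μ : ℝ | Module.End.HasEigenvalue (Matrix.toLin' (G.adjMatrix ℝ)) μ} (rho G) := by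
  have hfin : {μ : ℝ | Module.End.HasEigenvalue (Matrix.toLin' (G.adjMatrix ℝ)) μ}.Finite :=
    Module.End.finite_hasEigenvalue _
  have hne : {μ : ℝ | Module.End.HasEigenvalue (Matrix.toLin' (G.adjMatrix ℝ)) μ}.Nonempty := by
    have hA : (G.adjMatrix ℝ).IsHermitian := G.isHermitian_adjMatrix ℝ
    refine ⟨hA.eigenvalues (Classical.arbitrary V), ?_⟩
    rw [Set.mem_ofPred_eq, Module.End.hasEigenvalue_iff_mem_spectrum, Matrix.spectrum_toLin']
    exact hA.eigenvalues_mem_spectrum_real _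
  have h : rho G = sSup {μ : ℝ | Module.End.HasEigenvalue (Matrix.toLin' (G.adjMatrix ℝ)) μ} := by
    unfold rho
    congr!
  rw [h]
  exact ⟨hne.csSup_mem hfin, fun μ hμ => le_csSup hfin.bddAbove hμ⟩

/-- `C_t^+` (for `t ≥ 3`): the cycle `C_t` on the vertices `some i`, with the edge between `some 0`
and `some 1` identified with an edge of a triangle whose third vertex is `none`. -/
def cyclePlus (t : ℕ) [NeZero t] : SimpleGraph (Option (Fin t)) :=
  (SimpleGraph.cycleGraph t).map some ⊔
    SimpleGraph.fromEdgeSet {s(none, some 0), s(none, some 1)}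

/-- `S_{n,k}` (for `k ≤ n`): every vertex of a complete graph `K_k` (here on the vertices
`0, …, k - 1`) is joined to each of `n - k` isolated vertices. -/
def splitGraph (n k : ℕ) : SimpleGraph (Fin n) where
  Adj u v := u ≠ v ∧ (u.val < k ∨ v.val < k)
  symm := ⟨fun _ _ h => ⟨h.1.symm, h.2.symm⟩⟩
  loopless := ⟨fun _ h => h.1 rfl⟩

/-- `S_{n,2}^-` (for `n ≥ 4`): the graph `S_{n,2}` with one edge at a vertex of degree two deleted,
namely the edge between the vertex `1` of `K_2` and the degree-two vertex `2`. -/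
def splitGraphMinus (n : ℕ) : SimpleGraph (Fin n) :=
  (splitGraph n 2).deleteEdges {e | e.map Fin.val = s(1, 2)}

end SpectralTuran

namespace SpectralTuran

open scoped Classical
open Finset

/-! ### Variational facts about the spectral radius -/

section Spectral

variable {V : Type*} [Fintype V] (G : SimpleGraph V)

/-! Let r = ρ(G), let x ≥ 0 be an eigenvector for r with largest entry x u = 1, and let m be the
number of edges. Summing the eigenvalue equation over N(u) gives r² - r = m - loss
(`IsPerron.sq_sub_eq`). The loss has a term for each vertex of N(u), governed by its degree in the
link of u (the graph induced on N(u)), and nonnegative terms for the vertices outside N[u]. A test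
vector shows that the extremal graph satisfies r² - r ≥ m - 3/2 (`IsSplitMinus.le_rho`). So a graph
doing at least as well has total loss at most 3/2, and m ≥ 74 gives r > 9.

As u is joined to its whole link, a five-vertex path there would create C_5^+; the link is therefore
P_5-free. Let each vertex of degree one in the link hand its loss of 1/2 to its neighbour. Then only
deep vertices can have negative charge. These lie on small dense pieces (four-cycles or triangles),
where the entries of x are small because r > 9. Far neighbours could raise these entries, but such
far vertices lose more themselves. Hence one deep vertex already costs more than 3/2
(`IsPerron.not_isDeep`).

Without deep vertices the nontrivial components of the link are stars and double stars, each costing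
at least 1, so there is exactly one (`star_or_doubleStar`). The remaining budget of 1/2 excludes far
vertices, the double star, and two or more isolated vertices of the link. Evenness of m excludes
having none, which leaves S_{n,2}^-. -/

theorem posSemidef_rho_sub_adjMatrix [Nonempty V] :
    (Matrix.diagonal (fun _ : V => rho G) - G.adjMatrix ℝ).PosSemidef := by
  have hA : (Matrix.diagonal (fun _ : V => rho G) - G.adjMatrix ℝ).IsHermitian :=
    (Matrix.isHermitian_diagonal _).sub (G.isHermitian_adjMatrix ℝ)
  rw [hA.posSemidef_iff_eigenvalues_nonneg]
  intro i
  set μ := hA.eigenvalues i with hμ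
  set v : V → ℝ := (hA.eigenvectorBasis i).ofLp with hv
  have h1 : (Matrix.diagonal (fun _ : V => rho G) - G.adjMatrix ℝ).mulVec v = μ • v :=
    hA.mulVec_eigenvectorBasis i
  have hv0 : v ≠ 0 := by
    intro h
    have := hA.eigenvectorBasis.orthonormal.ne_zero i
    apply this
    ext j
    exact congrFun h j
  have h2 : (G.adjMatrix ℝ).mulVec v = (rho G - μ) • v := by
    rw [Matrix.sub_mulVec] at h1
    have h3 : (Matrix.diagonal (fun _ : V => rho G)).mulVec v = rho G • v := by
      ext j; simp [Matrix.mulVec_diagonal]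
    rw [h3] at h1
    rw [sub_smul, ← h1]; abel
  have h4 : Module.End.HasEigenvalue (Matrix.toLin' (G.adjMatrix ℝ)) (rho G - μ) :=
    Module.End.hasEigenvalue_of_hasEigenvector (x := v)
      ⟨Module.End.mem_eigenspace_iff.2 (by simpa using h2), hv0⟩
  have := (isGreatest_rho G).2 h4
  simp only [Pi.zero_apply]
  linarith

theorem adjMatrix_mulVec_eq_sum (x : V → ℝ) (v : V) :
    (G.adjMatrix ℝ).mulVec x v = ∑ w with G.Adj v w, x w := by
  rw [SimpleGraph.adjMatrix_mulVec_apply]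
  congr 1
  ext w; simp

theorem dotProduct_rho_sub_adjMatrix (x : V → ℝ) :
    x ⬝ᵥ (Matrix.diagonal (fun _ : V => rho G) - G.adjMatrix ℝ).mulVec x =
      ∑ v, x v * (rho G * x v - ∑ w with G.Adj v w, x w) := by
  simp only [dotProduct, Matrix.sub_mulVec, Pi.sub_apply, adjMatrix_mulVec_eq_sum,
    Matrix.mulVec_diagonal]

/-- Collatz–Wielandt lower bound for the spectral radius. -/
theorem le_rho_of_forall_mul_le_sum [Nonempty V] {x : V → ℝ} {c : ℝ} (hx : ∀ v, 0 ≤ x v)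
    (hx0 : ∃ v, x v ≠ 0) (h : ∀ v, c * x v ≤ ∑ w with G.Adj v w, x w) : c ≤ rho G := by
  have h1 := (posSemidef_rho_sub_adjMatrix G).dotProduct_mulVec_nonneg x
  rw [star_trivial, dotProduct_rho_sub_adjMatrix] at h1
  obtain ⟨v₀, hv₀⟩ := hx0
  by_contra! hc
  have h2 : ∑ v, x v * (rho G * x v - ∑ w with G.Adj v w, x w) < 0 := by
    refine Finset.sum_neg' (fun v _ => ?_) ⟨v₀, mem_univ _, ?_⟩
    · have h3 := h v
      have h4 : (rho G - c) * x v ≤ 0 := mul_nonpos_of_nonpos_of_nonneg (by linarith) (hx v)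
      exact mul_nonpos_of_nonneg_of_nonpos (hx v) (by linarith)
    · have := h v₀
      have := lt_of_le_of_ne (hx v₀) (Ne.symm hv₀)
      have : (rho G - c) * x v₀ < 0 := mul_neg_of_neg_of_pos (by linarith) this
      apply mul_neg_of_pos_of_neg <;> linarith
  linarith

/-- A nonnegative eigenvector for the spectral radius, with largest entry `1`. -/
theorem exists_perron_vector [Nonempty V] :
    ∃ (x : V → ℝ) (u : V), (∀ v, 0 ≤ x v) ∧ (∀ v, x v ≤ 1) ∧ x u = 1 ∧
      ∀ v, rho G * x v = ∑ w with G.Adj v w, x w := by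
  obtain ⟨y, hy⟩ := (isGreatest_rho G).1.exists_hasEigenvector
  have hy1 : (G.adjMatrix ℝ).mulVec y = rho G • y := by
    simpa using Module.End.mem_eigenspace_iff.1 hy.1
  have hy2 : ∀ v, rho G * y v = ∑ w with G.Adj v w, y w := fun v => by
    rw [← adjMatrix_mulVec_eq_sum, hy1]; simp
  set z : V → ℝ := fun v => |y v| with hz
  have hpsd := posSemidef_rho_sub_adjMatrix G
  -- Passing from y to |y| cannot increase the form of ρ - A, which vanishes at y. So |y| is a zero
  -- of a positive semidefinite form, hence in its kernel. Connectedness plays no role.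
  have hz0 : (Matrix.diagonal (fun _ : V => rho G) - G.adjMatrix ℝ).mulVec z = 0 := by
    rw [← hpsd.dotProduct_mulVec_zero_iff, star_trivial]
    apply le_antisymm
    · rw [dotProduct_rho_sub_adjMatrix]
      have : ∑ v, y v * (rho G * y v - ∑ w with G.Adj v w, y w) = 0 :=
        Finset.sum_eq_zero fun v _ => by rw [hy2]; ring
      rw [← this]
      refine Finset.sum_le_sum fun v _ => ?_
      have h1 : y v * ∑ w with G.Adj v w, y w ≤ z v * ∑ w with G.Adj v w, z w := by
        rw [Finset.mul_sum, Finset.mul_sum]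
        refine Finset.sum_le_sum fun w _ => ?_
        rw [hz, ← abs_mul]; exact le_abs_self _
      have h2 : z v * z v = y v * y v := abs_mul_abs_self _
      have h3 : rho G * (z v * z v) = rho G * (y v * y v) := by rw [h2]
      linarith
    · have := hpsd.dotProduct_mulVec_nonneg z
      rwa [star_trivial] at this
  have hz1 : ∀ v, rho G * z v = ∑ w with G.Adj v w, z w := fun v => by
    have := congrFun hz0 v
    rw [Matrix.sub_mulVec, Pi.sub_apply, adjMatrix_mulVec_eq_sum, Matrix.mulVec_diagonal] at this
    simpa [sub_eq_zero] using this
  obtain ⟨u, hu⟩ := Finite.exists_max z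
  have hupos : 0 < z u := by
    obtain ⟨v, hv⟩ := Function.ne_iff.1 hy.2
    exact lt_of_lt_of_le (abs_pos.2 hv) (hu v)
  refine ⟨fun v => z v / z u, u, fun v => by positivity, fun v => ?_, div_self hupos.ne',
    fun v => ?_⟩
  · exact (div_le_one hupos).2 (hu v)
  · rw [← Finset.sum_div, ← hz1 v]
    ring

theorem rho_le_of_iso [Nonempty V] {V' : Type*} [Fintype V'] [Nonempty V'] {G : SimpleGraph V}
    {G' : SimpleGraph V'} (e : G ≃g G') : rho G ≤ rho G' := by
  obtain ⟨x, u, h0, -, hu, hx⟩ := exists_perron_vector G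
  refine le_rho_of_forall_mul_le_sum G' (x := fun b => x (e.symm b)) (fun _ => h0 _)
    ⟨e u, by simp [hu]⟩ fun b => ?_
  rw [hx]
  refine le_of_eq (Finset.sum_bij (fun a _ => e a) ?_ ?_ ?_ ?_)
  · intro a ha
    simp only [mem_filter, mem_univ, true_and] at ha ⊢
    rw [← e.map_adj_iff] at ha
    simpa using ha
  · intro a _ a' _ h
    exact e.injective h
  · intro c hc
    refine ⟨e.symm c, ?_, by simp⟩
    simp only [mem_filter, mem_univ, true_and] at hc ⊢
    exact e.symm.map_adj_iff.2 hc
  · intro a _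
    simp

theorem rho_eq_of_iso [Nonempty V] {V' : Type*} [Fintype V'] [Nonempty V'] {G : SimpleGraph V}
    {G' : SimpleGraph V'} (e : G ≃g G') : rho G = rho G' :=
  le_antisymm (rho_le_of_iso e) (rho_le_of_iso e.symm)

end Spectral

/-! ### The extremal graph and a lower bound for its spectral radius -/

section SplitMinus

/-- `G` is a book-like graph `S_{n,2}^-`, with `u` and `b` the vertices of the `K_2` and `i` the
vertex of degree one, adjacent to `u`. -/
structure IsSplitMinus {V : Type*} (G : SimpleGraph V) (u b i : V) : Prop where
  hub : u ≠ b
  hui : u ≠ i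
  hbi : b ≠ i
  adj_iff : ∀ x y, G.Adj x y ↔
    x ≠ y ∧ (x = u ∨ y = u ∨ ((x = b ∨ y = b) ∧ x ≠ i ∧ y ≠ i))

theorem isSplitMinus_splitGraphMinus (r : ℕ) :
    IsSplitMinus (splitGraphMinus (r + 3)) 0 1 2 := by
  have h0 : ((0 : Fin (r + 3)) : ℕ) = 0 := rfl
  have h1 : ((1 : Fin (r + 3)) : ℕ) = 1 := rfl
  have h2 : ((2 : Fin (r + 3)) : ℕ) = 2 := rfl
  refine ⟨?_, ?_, ?_, fun x y => ?_⟩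
  · exact Fin.ne_of_val_ne (by omega)
  · exact Fin.ne_of_val_ne (by omega)
  · exact Fin.ne_of_val_ne (by omega)
  · simp only [splitGraphMinus, SimpleGraph.deleteEdges_adj, splitGraph, Set.mem_ofPred_eq,
      Sym2.map_mk, Sym2.eq_iff, ne_eq, Fin.ext_iff, h0, h1, h2]
    omega

theorem IsSplitMinus.nonempty_iso {V V' : Type*} [Fintype V] [Fintype V'] {G : SimpleGraph V}
    {G' : SimpleGraph V'} {u b i : V} {u' b' i' : V'} (h : IsSplitMinus G u b i)
    (h' : IsSplitMinus G' u' b' i') (hcard : Fintype.card V = Fintype.card V') :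
    Nonempty (G ≃g G') := by
  obtain ⟨e, he⟩ : ∃ e : V ≃ V', e u = u' :=
    ⟨(Fintype.equivOfCardEq hcard).trans (Equiv.swap (Fintype.equivOfCardEq hcard u) u'), by simp⟩
  obtain ⟨e, he, heb⟩ : ∃ e : V ≃ V', e u = u' ∧ e b = b' := by
    refine ⟨e.trans (Equiv.swap (e b) b'), ?_, by simp⟩
    simp only [Equiv.trans_apply, he]
    refine Equiv.swap_apply_of_ne_of_ne ?_ h'.hub
    rw [← he]
    exact e.injective.ne h.hub
  obtain ⟨e, he, heb, hei⟩ : ∃ e : V ≃ V', e u = u' ∧ e b = b' ∧ e i = i' := by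
    refine ⟨e.trans (Equiv.swap (e i) i'), ?_, ?_, by simp⟩
    · simp only [Equiv.trans_apply, he]
      refine Equiv.swap_apply_of_ne_of_ne ?_ h'.hui
      rw [← he]
      exact e.injective.ne h.hui
    · simp only [Equiv.trans_apply, heb]
      refine Equiv.swap_apply_of_ne_of_ne ?_ h'.hbi
      rw [← heb]
      exact e.injective.ne h.hbi
  refine ⟨⟨e, fun {x y} => ?_⟩⟩
  rw [h.adj_iff, h'.adj_iff, ← he, ← heb, ← hei]
  simp only [ne_eq, e.injective.eq_iff]

/-- On r + 3 vertices the graph has m = 2r + 2 edges, so the equation for c reads c² - c = m - 3/2.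
-/
theorem IsSplitMinus.le_rho {V : Type*} [Fintype V] {G : SimpleGraph V} {u b i : V}
    (h : IsSplitMinus G u b i) {r : ℕ} (hr : Fintype.card V = r + 3) {c : ℝ} (hc : 1 ≤ c)
    (hcr : c ^ 2 - c = 2 * r + 1 / 2) : c ≤ rho G := by
  have hc0 : 0 < c := by linarith
  -- With this β the test-vector inequalities at u and at b become equivalent; those at the other
  -- vertices are equalities.
  set β : ℝ := 1 - 1 / (c * (c + 1)) with hβ
  have hβ0 : 0 ≤ β := by
    rw [hβ, sub_nonneg, div_le_one (by positivity)]
    nlinarith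
  set x : V → ℝ := fun v => if v = u then 1 else if v = b then β else if v = i then 1 / c
    else (1 + β) / c with hx
  have xu : x u = 1 := by simp [hx]
  have xb : x b = β := by simp [hx, h.hub.symm]
  have xi : x i = 1 / c := by simp [hx, h.hui.symm, h.hbi.symm]
  set L : Finset V := univ.filter fun v => v ≠ u ∧ v ≠ b ∧ v ≠ i with hL
  have xL : ∀ v ∈ L, x v = (1 + β) / c := by
    intro v hv
    simp only [hL, mem_filter, mem_univ, true_and] at hv
    simp [hx, hv]
  have hLsum : ∑ v ∈ L, x v = r * ((1 + β) / c) := by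
    rw [sum_congr rfl xL, sum_const, nsmul_eq_mul]
    congr 2
    have : L = univ \ {u, b, i} := by
      ext v; simp [hL]
    rw [this, card_sdiff_of_subset (subset_univ _), card_univ, hr, card_eq_three.2
      ⟨u, b, i, h.hub, h.hui, h.hbi, rfl⟩]
    omega
  have hβc : (c + 1) * (1 - β) = 1 / c := by
    rw [hβ]; field_simp; ring
  have hrow : c ≤ β + 1 / c + r * ((1 + β) / c) := by
    have hδ : (c + r) * (1 / (c * (c + 1))) ≤ 1 / 2 := by
      rw [mul_one_div, div_le_iff₀ (by positivity)]
      nlinarith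
    have h1 : β + 1 / c + r * ((1 + β) / c) = (c * β + 1 + r * (1 + β)) / c := by
      field_simp
    rw [h1, le_div_iff₀ hc0, hβ]
    nlinarith
  have : Nonempty V := ⟨u⟩
  refine le_rho_of_forall_mul_le_sum G (x := x) (fun v => ?_) ⟨u, by simp [xu]⟩ fun v => ?_
  · simp only [hx]
    split_ifs <;> positivity
  · by_cases hvu : v = u
    · have : (univ.filter fun w => G.Adj v w) = insert b (insert i L) := by
        ext w
        simp only [mem_filter, mem_univ, true_and, mem_insert, hL, h.adj_iff]
        have := h.hub; have := h.hui
        grind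
      rw [this, sum_insert (by simp [hL, h.hbi]), sum_insert (by simp [hL]), hvu, xu, xb, xi,
        hLsum]
      linarith
    by_cases hvb : v = b
    · have : (univ.filter fun w => G.Adj v w) = insert u L := by
        ext w
        simp only [mem_filter, mem_univ, true_and, mem_insert, hL, h.adj_iff]
        have := h.hub; have := h.hbi
        grind
      rw [this, sum_insert (by simp [hL]), hvb, xu, xb, hLsum]
      linarith
    by_cases hvi : v = i
    · have : (univ.filter fun w => G.Adj v w) = {u} := by
        ext w
        simp only [mem_filter, mem_univ, true_and, mem_singleton, h.adj_iff]
        have := h.hui; have := h.hbi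
        grind
      rw [this, sum_singleton, hvi, xu, xi]
      field_simp
      rfl
    · have : (univ.filter fun w => G.Adj v w) = {u, b} := by
        ext w
        simp only [mem_filter, mem_univ, true_and, mem_singleton, mem_insert, h.adj_iff]
        have := h.hub; have := h.hbi
        grind
      rw [this, sum_pair h.hub, xu, xb, xL v (by simp [hL, hvu, hvb, hvi])]
      field_simp
      rfl

end SplitMinus

/-! ### P_5-free graphs and the discharging of degree-one vertices -/

section PathFree

variable {V : Type*} (H : SimpleGraph V)

/-- `H` has no path on five vertices (as a not necessarily induced subgraph). -/
def PathFiveFree : Prop :=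
  ∀ a b c d e, H.Adj a b → H.Adj b c → H.Adj c d → H.Adj d e →
    a ≠ c → a ≠ d → a ≠ e → b ≠ d → b ≠ e → c ≠ e → False

/-- `v` lies on a cycle of length four. -/
def InFourCycle (v : V) : Prop :=
  ∃ a b c, H.Adj v a ∧ H.Adj a b ∧ H.Adj b c ∧ H.Adj c v ∧ v ≠ b ∧ a ≠ c

variable {H}

/-- A vertex off the cycle but adjacent to it would start a five-vertex path running around the
cycle. So the component has just the four vertices of the cycle. -/
theorem InFourCycle.adj {v z : V} (hH : PathFiveFree H) (h : InFourCycle H v) (hz : H.Adj v z) :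
    InFourCycle H z := by
  obtain ⟨a, b, c, hva, hab, hbc, hcv, hvb, hac⟩ := h
  by_cases h1 : z = a
  · subst h1
    exact ⟨b, c, v, hab, hbc, hcv, hva, hac, hvb.symm⟩
  by_cases h2 : z = c
  · subst h2
    exact ⟨v, a, b, hcv, hva, hab, hbc, hac.symm, hvb⟩
  by_cases h3 : z = b
  · subst h3
    exact ⟨c, v, a, hbc, hcv, hva, hab, hvb.symm, hac.symm⟩
  exact (hH z v a b c hz.symm hva hab hbc h1 h3 h2 hvb hcv.ne.symm hac).elim

variable [Fintype V] (H)

/-- The number of neighbours of degree one. -/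
noncomputable def leafDegree (v : V) : ℕ := #{p ∈ H.neighborFinset v | H.degree p = 1}

/-- The number of neighbours of degree at least two. -/
noncomputable def coreDegree (v : V) : ℕ := #{p ∈ H.neighborFinset v | ¬ H.degree p = 1}

/-- `v` has degree at least two, and so do all its neighbours. -/
def IsDeep (v : V) : Prop := 2 ≤ H.degree v ∧ ∀ a, H.Adj v a → 2 ≤ H.degree a

variable {H}

theorem leafDegree_add_coreDegree (v : V) : leafDegree H v + coreDegree H v = H.degree v := by
  unfold leafDegree coreDegree
  rw [card_filter_add_card_filter_not, SimpleGraph.card_neighborFinset_eq_degree]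

theorem eq_of_degree_eq_one {v a b : V} (hv : H.degree v = 1) (ha : H.Adj v a) (hb : H.Adj v b) :
    a = b := by
  rw [← SimpleGraph.card_neighborFinset_eq_degree, card_eq_one] at hv
  obtain ⟨c, hc⟩ := hv
  have h1 : a ∈ H.neighborFinset v := by simpa using ha
  have h2 : b ∈ H.neighborFinset v := by simpa using hb
  rw [hc, mem_singleton] at h1 h2
  rw [h1, h2]

theorem two_le_degree_of_adj {v a b : V} (ha : H.Adj v a) (hb : H.Adj v b) (hab : a ≠ b) :
    2 ≤ H.degree v := by
  rw [← SimpleGraph.card_neighborFinset_eq_degree]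
  exact one_lt_card.2 ⟨a, by simpa using ha, b, by simpa using hb, hab⟩

theorem exists_adj_of_two_le_degree {v : V} (hv : 2 ≤ H.degree v) (a : V) :
    ∃ b, H.Adj v b ∧ b ≠ a := by
  rw [← SimpleGraph.card_neighborFinset_eq_degree] at hv
  obtain ⟨b, hb, hba⟩ := exists_mem_ne hv a
  exact ⟨b, by simpa using hb, hba⟩

theorem degree_pos_of_adj {v a : V} (ha : H.Adj v a) : 0 < H.degree v :=
  (H.degree_pos_iff_exists_adj v).2 ⟨a, ha⟩

theorem two_le_degree_of_ne_one {v a : V} (ha : H.Adj v a) (h : H.degree v ≠ 1) :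
    2 ≤ H.degree v := by
  have := degree_pos_of_adj ha
  omega

theorem leafDegree_pos {v p : V} (h : H.Adj v p) (hp : H.degree p = 1) : 0 < leafDegree H v :=
  card_pos.2 ⟨p, by simp [h, hp]⟩

theorem exists_leaf_of_not_isDeep {v : V} (hv : 2 ≤ H.degree v) (h : ¬ IsDeep H v) :
    ∃ p, H.Adj v p ∧ H.degree p = 1 := by
  simp only [IsDeep, not_and, not_forall] at h
  obtain ⟨p, hp, hp2⟩ := h hv
  exact ⟨p, hp, by have := degree_pos_of_adj hp.symm; omega⟩

theorem leafDegree_eq_zero_of_isDeep {v : V} (h : IsDeep H v) : leafDegree H v = 0 := by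
  unfold leafDegree
  rw [card_eq_zero, filter_eq_empty_iff]
  intro p hp
  have := h.2 p (by simpa using hp)
  omega

theorem InFourCycle.isDeep {v : V} (hH : PathFiveFree H) (h : InFourCycle H v) : IsDeep H v := by
  obtain ⟨a, b, c, hva, hab, hbc, hcv, hvb, hac⟩ := h
  refine ⟨two_le_degree_of_adj hva hcv.symm hac, fun z hz => ?_⟩
  by_cases h1 : z = a
  · subst h1
    exact two_le_degree_of_adj hva.symm hab hvb
  by_cases h2 : z = c
  · subst h2
    exact two_le_degree_of_adj hcv hbc.symm hvb
  by_cases h3 : z = b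
  · subst h3
    exact two_le_degree_of_adj hbc hab.symm hac.symm
  exact (hH z v a b c hz.symm hva hab hbc h1 h3 h2 hvb hcv.ne.symm hac).elim

theorem InFourCycle.degree_le {v : V} (hH : PathFiveFree H) (h : InFourCycle H v) :
    H.degree v ≤ 3 := by
  obtain ⟨a, b, c, hva, hab, hbc, hcv, hvb, hac⟩ := h
  rw [← SimpleGraph.card_neighborFinset_eq_degree]
  refine le_trans (card_le_card (t := {a, b, c}) fun z hz => ?_) card_le_three
  simp only [SimpleGraph.mem_neighborFinset] at hz
  simp only [mem_insert, mem_singleton]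
  by_contra! h
  exact hH z v a b c hz.symm hva hab hbc h.1 h.2.1 h.2.2 hvb hcv.ne.symm hac

/-- Two nonadjacent neighbours of v both continue away from v, giving a five-vertex path or a
four-cycle through v. So the neighbours are pairwise adjacent, and three of them would again put v
on a four-cycle. -/
theorem exists_triangle_of_isDeep {v : V} (hH : PathFiveFree H) (hv : IsDeep H v)
    (hc : ¬ InFourCycle H v) :
    ∃ a c, H.Adj v a ∧ H.Adj v c ∧ H.Adj a c ∧ H.neighborFinset v = {a, c} := by
  have key : ∀ a c, H.Adj v a → H.Adj v c → a ≠ c → H.Adj a c := by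
    intro a c ha hvc hac
    by_contra hn
    obtain ⟨a', ha', hav⟩ := exists_adj_of_two_le_degree (hv.2 a ha) v
    obtain ⟨c', hc', hcv⟩ := exists_adj_of_two_le_degree (hv.2 c hvc) v
    by_cases h : a' = c'
    · subst h
      exact hc ⟨a, a', c, ha, ha', hc'.symm, hvc.symm, hav.symm, hac⟩
    · exact hH a' a v c c' ha'.symm ha.symm hvc hc' hav (by grind) h hac
        (by grind [H.adj_comm]) hcv.symm
  obtain ⟨a, ha, -⟩ := exists_adj_of_two_le_degree hv.1 v
  obtain ⟨c, hcv, hca⟩ := exists_adj_of_two_le_degree hv.1 a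
  refine ⟨a, c, ha, hcv, key a c ha hcv hca.symm, ?_⟩
  ext z
  simp only [SimpleGraph.mem_neighborFinset, mem_insert, mem_singleton]
  constructor
  · intro hz
    by_contra! h
    exact hc ⟨a, c, z, ha, key a c ha hcv hca.symm, key c z hcv hz h.2.symm, hz.symm,
      hcv.ne, h.1.symm⟩
  · rintro (rfl | rfl) <;> assumption

/-- If both other vertices of the triangle carried a leaf, the path leaf, a, v, c, leaf would have
five vertices. -/
theorem exists_adj_isDeep_not_inFourCycle {v : V} (hH : PathFiveFree H) (hv : IsDeep H v)
    (hc : ¬ InFourCycle H v) : ∃ a, H.Adj v a ∧ IsDeep H a ∧ ¬ InFourCycle H a := by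
  obtain ⟨a, c, ha, hcv, hac, hn⟩ := exists_triangle_of_isDeep hH hv hc
  by_cases hda : IsDeep H a
  · exact ⟨a, ha, hda, fun h => hc (h.adj hH ha.symm)⟩
  by_cases hdc : IsDeep H c
  · exact ⟨c, hcv, hdc, fun h => hc (h.adj hH hcv.symm)⟩
  obtain ⟨a', ha', hla⟩ := exists_leaf_of_not_isDeep (hv.2 a ha) hda
  obtain ⟨c', hc', hlc⟩ := exists_leaf_of_not_isDeep (hv.2 c hcv) hdc
  have h2 := hv.1
  have h3 := hv.2 a ha
  have h4 := hv.2 c hcv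
  refine (hH a' a v c c' ha'.symm ha.symm hcv hc' ?_ ?_ ?_ hac.ne ?_ ?_).elim
  · rintro rfl; omega
  · rintro rfl; omega
  · rintro rfl
    exact hac.ne (eq_of_degree_eq_one hla ha'.symm hc'.symm)
  · rintro rfl; omega
  · rintro rfl; omega

/-- A vertex that is not deep carries a leaf p. Its neighbours of degree at least two are pairwise
adjacent, so three of them would extend p, v to a five-vertex path. -/
theorem coreDegree_le_two {v : V} (hH : PathFiveFree H) (hv : 2 ≤ H.degree v)
    (h : ¬ IsDeep H v) : coreDegree H v ≤ 2 := by
  obtain ⟨p, hp, hp1⟩ := exists_leaf_of_not_isDeep hv h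
  by_contra! hk
  obtain ⟨a, ha, b, hb, c, hc, hab, hac, hbc⟩ := two_lt_card.1 hk
  simp only [mem_filter, SimpleGraph.mem_neighborFinset] at ha hb hc
  have key : ∀ a b, H.Adj v a → H.Adj v b → H.degree a ≠ 1 → H.degree b ≠ 1 → a ≠ b →
      H.Adj a b := by
    intro a b ha hb hda hdb hab
    by_contra hn
    obtain ⟨a', ha', hav⟩ := exists_adj_of_two_le_degree (two_le_degree_of_ne_one ha.symm hda) v
    obtain ⟨b', hb', hbv⟩ := exists_adj_of_two_le_degree (two_le_degree_of_ne_one hb.symm hdb) v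
    by_cases h : a' = b'
    · subst h
      refine hH p v a a' b hp.symm ha ha' hb'.symm (by grind) ?_ (by grind) hav.symm hb.ne hab
      rintro rfl
      exact hab (eq_of_degree_eq_one hp1 ha'.symm hb'.symm)
    · exact hH a' a v b b' ha'.symm ha.symm hb hb' hav (by grind) h hab
        (by grind [H.adj_comm]) hbv.symm
  exact hH p v a b c hp.symm ha.1 (key a b ha.1 hb.1 ha.2 hb.2 hab)
    (key b c hb.1 hc.1 hb.2 hc.2 hbc) (by grind) (by grind) (by grind) hb.1.ne hc.1.ne hac

/-- Two such neighbours, not being deep, would each carry a leaf, giving a five-vertex path centred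
at v. -/
theorem coreDegree_le_one {v : V} (hH : PathFiveFree H) (hdeep : ∀ a, ¬ IsDeep H a) :
    coreDegree H v ≤ 1 := by
  by_contra! hk
  obtain ⟨a, ha, b, hb, hab⟩ := one_lt_card.1 hk
  simp only [mem_filter, SimpleGraph.mem_neighborFinset] at ha hb
  have hv := two_le_degree_of_adj ha.1 hb.1 hab
  obtain ⟨a', ha', hla⟩ :=
    exists_leaf_of_not_isDeep (two_le_degree_of_ne_one ha.1.symm ha.2) (hdeep a)
  obtain ⟨b', hb', hlb⟩ :=
    exists_leaf_of_not_isDeep (two_le_degree_of_ne_one hb.1.symm hb.2) (hdeep b)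
  refine hH a' a v b b' ha'.symm ha.1.symm hb.1 hb' ?_ ?_ ?_ hab ?_ ?_
  · rintro rfl; omega
  · rintro rfl; omega
  · rintro rfl
    exact hab (eq_of_degree_eq_one hla ha'.symm hb'.symm)
  · rintro rfl; omega
  · rintro rfl; omega

/-- The deficit of a vertex, after each vertex of degree one has passed its share on to its
neighbour. -/
noncomputable def charge (H : SimpleGraph V) (x : V → ℝ) (v : V) : ℝ :=
  H.degree v / 2 - (H.degree v - 1) * x v - (if H.degree v = 1 then 1 / 2 else 0) +
    leafDegree H v / 2

theorem sum_leafDegree {N : Finset V} (hN : ∀ v, H.degree v ≠ 0 → v ∈ N) :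
    ∑ v ∈ N, leafDegree H v = #{v ∈ N | H.degree v = 1} := by
  simp only [leafDegree, card_eq_sum_ones, sum_filter, SimpleGraph.neighborFinset_eq_filter]
  have h1 : ∀ v ∈ N, (∑ p, if H.Adj v p then if H.degree p = 1 then 1 else 0 else 0) =
      ∑ p ∈ N, if H.Adj v p then if H.degree p = 1 then 1 else 0 else 0 := by
    intro v _
    symm
    refine sum_subset (subset_univ _) fun p _ hp => ?_
    have : H.degree p = 0 := by
      by_contra h
      exact hp (hN p h)
    simp [this]
  rw [sum_congr rfl h1, sum_comm]
  refine sum_congr rfl fun p _ => ?_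
  by_cases hp : H.degree p = 1
  · simp only [hp, if_true]
    have : ∑ v ∈ N, (if H.Adj v p then 1 else 0) = #(H.neighborFinset p) := by
      rw [← sum_filter, ← card_eq_sum_ones]
      congr 1
      ext v
      simp only [mem_filter, SimpleGraph.mem_neighborFinset]
      exact ⟨fun h => h.2.symm, fun h => ⟨hN v (degree_pos_of_adj h.symm).ne', h.symm⟩⟩
    rw [this, SimpleGraph.card_neighborFinset_eq_degree, hp]
  · simp [hp]

/-- Discharging preserves the total: each vertex of degree one gives 1/2 to its only neighbour. -/
theorem sum_charge {N : Finset V} (hN : ∀ v, H.degree v ≠ 0 → v ∈ N) (x : V → ℝ) :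
    ∑ v ∈ N, charge H x v = ∑ v ∈ N, ((H.degree v : ℝ) / 2 - (H.degree v - 1) * x v) := by
  have h := sum_leafDegree hN
  have h' : ∑ v ∈ N, (leafDegree H v : ℝ) = #{v ∈ N | H.degree v = 1} := by exact_mod_cast h
  have h2 : ∑ v ∈ N, (if H.degree v = 1 then (1 : ℝ) / 2 else 0) =
      #{v ∈ N | H.degree v = 1} / 2 := by
    rw [← sum_filter, sum_const, nsmul_eq_mul]
    ring
  unfold charge
  rw [sum_add_distrib, sum_sub_distrib, h2, ← sum_div, h']
  ring

theorem charge_of_degree_eq_zero {x : V → ℝ} {v : V} (h : H.degree v = 0) :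
    charge H x v = x v := by
  have := leafDegree_add_coreDegree (H := H) v
  have h1 : leafDegree H v = 0 := by omega
  simp [charge, h, h1]

theorem charge_of_degree_eq_one {x : V → ℝ} {v : V} (h : H.degree v = 1) :
    charge H x v = leafDegree H v / 2 := by
  simp [charge, h]

theorem charge_of_two_le_degree {x : V → ℝ} {v : V} (h : 2 ≤ H.degree v) :
    charge H x v = (H.degree v - 1) * (1 - x v) + 1 - coreDegree H v / 2 := by
  have h1 : (leafDegree H v : ℝ) = H.degree v - coreDegree H v := by
    rw [← leafDegree_add_coreDegree]
    push_cast
    ring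
  have h2 : H.degree v ≠ 1 := by omega
  simp only [charge, h1, h2, if_false]
  ring

theorem charge_of_isDeep {x : V → ℝ} {v : V} (h : IsDeep H v) :
    charge H x v = H.degree v / 2 - (H.degree v - 1) * x v := by
  have h2 : H.degree v ≠ 1 := by have := h.1; omega
  simp [charge, leafDegree_eq_zero_of_isDeep h, h2]

theorem one_sub_le_charge {x : V → ℝ} {v : V} (h : 2 ≤ H.degree v) (hx : x v ≤ 1) :
    1 - (coreDegree H v : ℝ) / 2 ≤ charge H x v := by
  rw [charge_of_two_le_degree h]
  have : (2 : ℝ) ≤ H.degree v := by exact_mod_cast h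
  have : 0 ≤ ((H.degree v : ℝ) - 1) * (1 - x v) := mul_nonneg (by linarith) (by linarith)
  linarith

/-- The charge of a vertex of degree at least two is at least 1 minus half its core degree, and
`coreDegree_le_two` bounds that degree. -/
theorem charge_nonneg {x : V → ℝ} (hH : PathFiveFree H) {v : V} (h0 : 0 ≤ x v) (h1 : x v ≤ 1)
    (h : ¬ IsDeep H v) : 0 ≤ charge H x v := by
  rcases Nat.lt_or_ge (H.degree v) 2 with h2 | h2
  · interval_cases hd : H.degree v
    · rwa [charge_of_degree_eq_zero hd]
    · rw [charge_of_degree_eq_one hd]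
      positivity
  · have h3 := one_sub_le_charge h2 h1
    have h4 : (coreDegree H v : ℝ) ≤ 2 := by exact_mod_cast coreDegree_le_two hH h2 h
    linarith

end PathFree

/-! ### The link of a vertex and edge counting around it -/

section Link

variable {V : Type*} (G : SimpleGraph V) (u : V)

/-- The graph induced by `G` on the neighbourhood of `u`, with all other vertices isolated. -/
def link : SimpleGraph V where
  Adj a b := G.Adj a b ∧ G.Adj u a ∧ G.Adj u b
  symm := ⟨fun _ _ h => ⟨h.1.symm, h.2.2, h.2.1⟩⟩
  loopless := ⟨fun _ h => h.1.ne rfl⟩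

variable {G u}

theorem link_adj {a b : V} : (link G u).Adj a b ↔ G.Adj a b ∧ G.Adj u a ∧ G.Adj u b := Iff.rfl

/-- The five-cycle is a, b, c, d, e and t is the apex of the triangle on ab. Distinctness is assumed
only for pairs not already joined by an edge. -/
theorem false_of_cyclePlus_five (hfree : (cyclePlus 5).Free G) {a b c d e t : V}
    (hab : G.Adj a b) (hbc : G.Adj b c) (hcd : G.Adj c d) (hde : G.Adj d e) (hea : G.Adj e a)
    (hta : G.Adj t a) (htb : G.Adj t b) (hac : a ≠ c) (had : a ≠ d) (hbd : b ≠ d) (hbe : b ≠ e)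
    (hce : c ≠ e) (htc : t ≠ c) (htd : t ≠ d) (hte : t ≠ e) : False := by
  apply hfree
  let f : Option (Fin 5) → V := fun o => o.elim t ![a, b, c, d, e]
  have hf : Function.Injective f := by
    have h1 := hab.ne; have h2 := hbc.ne; have h3 := hcd.ne; have h4 := hde.ne
    have h5 := hea.ne; have h6 := hta.ne; have h7 := htb.ne
    intro o o' h
    rcases o with - | i <;> rcases o' with - | j
    · rfl
    · fin_cases j <;> simp [f] at h <;> grind
    · fin_cases i <;> simp [f] at h <;> grind
    · fin_cases i <;> fin_cases j <;> simp [f] at h ⊢ <;> grind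
  have hstep : ∀ i : Fin 5, G.Adj (f (some i)) (f (some (i + 1))) := by
    intro i
    fin_cases i <;> assumption
  refine ⟨⟨⟨f, ?_⟩, hf⟩⟩
  intro o o' h
  simp only [cyclePlus, SimpleGraph.sup_adj, SimpleGraph.fromEdgeSet_adj] at h
  rcases h with ⟨-, i, j, hij, rfl, rfl⟩ | ⟨h, -⟩
  · rw [SimpleGraph.cycleGraph_adj] at hij
    rw [sub_eq_iff_eq_add', sub_eq_iff_eq_add'] at hij
    rcases hij with rfl | rfl
    · exact (hstep j).symm
    · exact hstep i
  · simp only [Set.mem_insert_iff, Set.mem_singleton_iff, Sym2.eq_iff] at h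
    rcases h with (⟨rfl, rfl⟩ | ⟨rfl, rfl⟩) | (⟨rfl, rfl⟩ | ⟨rfl, rfl⟩)
    · exact hta
    · exact hta.symm
    · exact htb
    · exact htb.symm

theorem pathFiveFree_link (hfree : (cyclePlus 5).Free G) : PathFiveFree (link G u) := by
  intro a b c d e hab hbc hcd hde hac had hae hbd hbe hce
  -- The five-cycle is u, b, c, d, e; the first path vertex a is the apex over the edge ub.
  exact false_of_cyclePlus_five hfree (a := u) (b := b) (c := c) (d := d) (e := e) (t := a)
    hab.2.2 hbc.1 hcd.1 hde.1 hde.2.2.symm hab.2.1.symm hab.1 hbc.2.2.ne hcd.2.2.ne hbd hbe hce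
    hac had hae

theorem sum_sum_adj (A B : Finset V) (f : V → ℝ) :
    ∑ v ∈ A, ∑ w ∈ B with G.Adj v w, f w = ∑ w ∈ B, (#{v ∈ A | G.Adj w v} : ℝ) * f w := by
  simp only [sum_filter]
  rw [sum_comm]
  refine sum_congr rfl fun w _ => ?_
  rw [← sum_filter, sum_const, nsmul_eq_mul]
  simp only [G.adj_comm]

variable [Fintype V]

variable (G u) in
/-- The neighbours of `u`. -/
noncomputable def near : Finset V := {v | G.Adj u v}

variable (G u) in
/-- The vertices other than `u` that are not adjacent to `u`. -/
noncomputable def far : Finset V := {v | v ≠ u ∧ ¬ G.Adj u v}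

@[simp] theorem mem_near {v : V} : v ∈ near G u ↔ G.Adj u v := by simp [near]

@[simp] theorem mem_far {v : V} : v ∈ far G u ↔ v ≠ u ∧ ¬ G.Adj u v := by simp [far]

theorem sum_univ_eq_near_far (f : V → ℝ) :
    ∑ v, f v = f u + ∑ v ∈ near G u, f v + ∑ v ∈ far G u, f v := by
  have h : (univ : Finset V) = insert u (near G u ∪ far G u) := by
    ext v
    simp only [mem_univ, mem_insert, mem_union, mem_near, mem_far, true_iff]
    tauto
  rw [h, sum_insert (by simp), sum_union, add_assoc]
  rw [disjoint_left]
  simp +contextual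

theorem sum_adj_eq_near_far (v : V) (f : V → ℝ) :
    ∑ w with G.Adj v w, f w = (if G.Adj v u then f u else 0) +
      ∑ w ∈ near G u with G.Adj v w, f w + ∑ w ∈ far G u with G.Adj v w, f w := by
  rw [sum_filter, sum_univ_eq_near_far (G := G) (u := u), sum_filter, sum_filter]

theorem neighborFinset_link {v : V} (hv : G.Adj u v) :
    (link G u).neighborFinset v = {w ∈ near G u | G.Adj v w} := by
  ext w
  simp only [SimpleGraph.mem_neighborFinset, link_adj, mem_filter, mem_near]
  tauto

theorem degree_link {v : V} (hv : G.Adj u v) :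
    (link G u).degree v = #{w ∈ near G u | G.Adj v w} := by
  rw [← neighborFinset_link hv, SimpleGraph.card_neighborFinset_eq_degree]

theorem mem_near_of_degree_link_ne_zero (v : V) (hv : (link G u).degree v ≠ 0) :
    v ∈ near G u := by
  obtain ⟨w, hw⟩ := ((link G u).degree_pos_iff_exists_adj v).1 (Nat.pos_of_ne_zero hv)
  exact mem_near.2 hw.2.1

theorem ncard_edgeSet_eq :
    (G.edgeSet.ncard : ℝ) = #(near G u) + (∑ v ∈ near G u, ((link G u).degree v : ℝ)) / 2 +
      ∑ w ∈ far G u, (#{v ∈ near G u | G.Adj w v} : ℝ) +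
      (∑ w ∈ far G u, (#{v ∈ far G u | G.Adj w v} : ℝ)) / 2 := by
  have h1 : (∑ v, (G.degree v : ℝ)) = 2 * G.edgeSet.ncard := by
    have := G.sum_degrees_eq_twice_card_edges
    rw [← SimpleGraph.coe_edgeFinset, Set.ncard_coe_finset]
    exact_mod_cast this
  have h2 : ∀ v, (G.degree v : ℝ) = (if G.Adj v u then 1 else 0) +
      (#{w ∈ near G u | G.Adj v w} : ℝ) + (#{w ∈ far G u | G.Adj v w} : ℝ) := by
    intro v
    have := sum_adj_eq_near_far (G := G) (u := u) v (fun _ => 1)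
    simp only [sum_const, nsmul_eq_mul, mul_one] at this
    rw [← this, ← SimpleGraph.card_neighborFinset_eq_degree, SimpleGraph.neighborFinset_eq_filter]
  have h3 : ∑ v ∈ near G u, (#{w ∈ far G u | G.Adj v w} : ℝ) =
      ∑ w ∈ far G u, (#{v ∈ near G u | G.Adj w v} : ℝ) := by
    have := sum_sum_adj (G := G) (near G u) (far G u) (fun _ => 1)
    simpa only [sum_const, nsmul_eq_mul, mul_one] using this
  have hu : (G.degree u : ℝ) = #(near G u) := by
    rw [← SimpleGraph.card_neighborFinset_eq_degree, SimpleGraph.neighborFinset_eq_filter, near]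
  have hN : ∀ v ∈ near G u, (G.degree v : ℝ) = 1 + ((link G u).degree v : ℝ) +
      (#{w ∈ far G u | G.Adj v w} : ℝ) := by
    intro v hv
    rw [h2, degree_link (mem_near.1 hv), if_pos (mem_near.1 hv).symm]
  have hW : ∀ w ∈ far G u, (G.degree w : ℝ) =
      (#{v ∈ near G u | G.Adj w v} : ℝ) + (#{v ∈ far G u | G.Adj w v} : ℝ) := by
    intro w hw
    rw [h2, if_neg (fun h => (mem_far.1 hw).2 h.symm), zero_add]
  rw [sum_univ_eq_near_far (G := G) (u := u), hu, sum_congr rfl hN, sum_congr rfl hW,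
    sum_add_distrib, sum_add_distrib, sum_add_distrib, h3] at h1
  simp only [sum_const, nsmul_eq_mul, mul_one] at h1
  linarith

end Link

/-! ### Eigenvalue equations and the loss identity -/

section Perron

variable {V : Type*} [Fintype V] {G : SimpleGraph V} {u : V} {x : V → ℝ} {r : ℝ}

/-- `x` is a nonnegative eigenvector of `G` for the eigenvalue `r`, and its largest entry is
`x u = 1`. -/
structure IsPerron (G : SimpleGraph V) (u : V) (x : V → ℝ) (r : ℝ) : Prop where
  nonneg : ∀ v, 0 ≤ x v
  le_one : ∀ v, x v ≤ 1
  eq_one : x u = 1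
  eig : ∀ v, r * x v = ∑ w with G.Adj v w, x w

namespace IsPerron

variable (hx : IsPerron G u x r)
include hx

theorem sum_near : ∑ v ∈ near G u, x v = r := by
  have := hx.eig u
  rw [hx.eq_one, mul_one] at this
  exact this.symm

theorem eig_near {v : V} (hv : G.Adj u v) : r * x v =
    1 + ∑ w ∈ (link G u).neighborFinset v, x w + ∑ w ∈ far G u with G.Adj v w, x w := by
  rw [hx.eig, sum_adj_eq_near_far (u := u), if_pos hv.symm, hx.eq_one, neighborFinset_link hv]

theorem eig_far {w : V} (hw : w ∈ far G u) : r * x w =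
    ∑ v ∈ near G u with G.Adj w v, x v + ∑ v ∈ far G u with G.Adj w v, x v := by
  rw [hx.eig, sum_adj_eq_near_far (u := u), if_neg (fun h => (mem_far.1 hw).2 h.symm), zero_add]

theorem sum_le_card (s : Finset V) : ∑ v ∈ s, x v ≤ #s := by
  have := sum_le_sum fun v (_ : v ∈ s) => hx.le_one v
  simpa using this

/-- This is the eigenvalue equation iterated twice at u: the walks of length two from u, grouped by
endpoint (u itself, N(u), far vertices). -/
theorem sq_eq : r ^ 2 = #(near G u) + ∑ v ∈ near G u, ((link G u).degree v : ℝ) * x v +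
    ∑ w ∈ far G u, (#{v ∈ near G u | G.Adj w v} : ℝ) * x w := by
  have h1 : r ^ 2 = ∑ v ∈ near G u, r * x v := by
    rw [← mul_sum, hx.sum_near, sq]
  have h2 : ∑ v ∈ near G u, ∑ w ∈ (link G u).neighborFinset v, x w =
      ∑ v ∈ near G u, ((link G u).degree v : ℝ) * x v := by
    have h3 : ∀ v ∈ near G u, ∑ w ∈ (link G u).neighborFinset v, x w =
        ∑ w ∈ near G u with G.Adj v w, x w := fun v hv => by
      rw [neighborFinset_link (mem_near.1 hv)]
    have h4 : ∀ v ∈ near G u, ((link G u).degree v : ℝ) * x v =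
        (#{w ∈ near G u | G.Adj v w} : ℝ) * x v := fun v hv => by
      rw [degree_link (mem_near.1 hv)]
    rw [sum_congr rfl h3, sum_congr rfl h4, sum_sum_adj]
  rw [h1, sum_congr rfl fun v hv => hx.eig_near (mem_near.1 hv), sum_add_distrib,
    sum_add_distrib, sum_sum_adj, h2]
  simp

/-- Subtracting r = ∑ x v over N(u) lowers the coefficient of x v to its link degree minus one;
comparing with the edge count leaves the losses. -/
theorem sq_sub_eq : r ^ 2 - r = G.edgeSet.ncard - ∑ v ∈ near G u, charge (link G u) x v -
    ∑ w ∈ far G u, (#{v ∈ near G u | G.Adj w v} : ℝ) * (1 - x w) -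
    (∑ w ∈ far G u, (#{v ∈ far G u | G.Adj w v} : ℝ)) / 2 := by
  rw [sum_charge mem_near_of_degree_link_ne_zero, ncard_edgeSet_eq (u := u), hx.sq_eq]
  simp only [sub_mul, one_mul, mul_sub, mul_one, sum_sub_distrib, hx.sum_near, ← sum_div]
  ring

end IsPerron

end Perron

/-! ### Excluding deep vertices of the link -/

section NoDeep

variable {V : Type*} [Fintype V] {G : SimpleGraph V} {u : V} {x : V → ℝ} {r : ℝ}

/-- If w had a further neighbour p in N(u), outside the four-cycle or triangle at v, then u, p, w, v
and one more vertex of that piece would form a five-cycle, with another vertex of the piece as apex.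
-/
theorem card_near_filter_adj_le_four (hfree : (cyclePlus 5).Free G) {v w : V} (hw : w ∈ far G u)
    (hwv : G.Adj w v) (hv : IsDeep (link G u) v) : #{p ∈ near G u | G.Adj w p} ≤ 4 := by
  have hH := pathFiveFree_link (u := u) hfree
  obtain ⟨hwu, hwu'⟩ := mem_far.1 hw
  have hwN : ∀ a, G.Adj u a → w ≠ a := by
    rintro a ha rfl
    exact hwu' ha
  by_cases hc : InFourCycle (link G u) v
  · obtain ⟨a, b, c, hva, hab, hbc, hcv, hvb, hac⟩ := hc
    refine le_trans (card_le_card (t := {v, a, b, c}) fun p hp => ?_) card_le_four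
    simp only [mem_filter, mem_near] at hp
    simp only [mem_insert, mem_singleton]
    by_contra! h
    exact false_of_cyclePlus_five hfree (a := a) (b := u) (c := p) (d := w) (e := v) (t := b)
      hva.2.2.symm hp.1 hp.2.symm hwv hva.1 hab.1.symm hab.2.2.symm (Ne.symm h.2.1)
      (hwN a hva.2.2).symm hwu.symm hva.2.1.ne h.1 (Ne.symm h.2.2.1) (hwN b hab.2.2).symm hvb.symm
  · obtain ⟨a, c, hva, hvc, hac, -⟩ := exists_triangle_of_isDeep hH hv hc
    refine le_trans (card_le_card (t := {v, a, c}) fun p hp => ?_)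
      (card_le_three.trans (by norm_num))
    simp only [mem_filter, mem_near] at hp
    simp only [mem_insert, mem_singleton]
    by_contra! h
    exact false_of_cyclePlus_five hfree (a := v) (b := a) (c := u) (d := p) (e := w) (t := c)
      hva.1 hva.2.2.symm hp.1 hp.2.symm hwv hvc.1.symm hac.1.symm hva.2.1.ne.symm (Ne.symm h.1)
      (Ne.symm h.2.1) (hwN a hva.2.2).symm hwu.symm hvc.2.2.ne.symm (Ne.symm h.2.2)
      (hwN c hvc.2.2).symm

namespace IsPerron

/-- The loss caused by a vertex outside the closed neighbourhood of `u`. -/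
noncomputable def farLoss (G : SimpleGraph V) (u : V) (x : V → ℝ) (w : V) : ℝ :=
  (#{v ∈ near G u | G.Adj w v} : ℝ) * (1 - x w) + (#{v ∈ far G u | G.Adj w v} : ℝ) / 2

variable (hx : IsPerron G u x r)
include hx

theorem farLoss_nonneg (w : V) : 0 ≤ farLoss G u x w := by
  have := hx.le_one w
  have : 0 ≤ (#{v ∈ near G u | G.Adj w v} : ℝ) * (1 - x w) :=
    mul_nonneg (Nat.cast_nonneg _) (by linarith)
  unfold farLoss
  positivity

theorem sq_sub_eq_sub_farLoss : r ^ 2 - r = G.edgeSet.ncard -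
    ∑ v ∈ near G u, charge (link G u) x v - ∑ w ∈ far G u, farLoss G u x w := by
  rw [hx.sq_sub_eq]
  simp only [farLoss, sum_add_distrib, sum_div]
  ring

/-- With a near and b far neighbours, r x w ≤ a + b, so a ≤ 4 and r > 9 give 9 a x w ≤ 4(a + b).
Rearranged, 5 a x w ≤ 4 a (1 - x w) + 8 (b / 2). -/
theorem mul_le_farLoss (hr : 9 < r) {w : V} (hw : w ∈ far G u)
    (h4 : #{v ∈ near G u | G.Adj w v} ≤ 4) :
    (#{v ∈ near G u | G.Adj w v} : ℝ) * x w ≤ 8 / 5 * farLoss G u x w := by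
  have h1 := hx.eig_far hw
  have h2 := hx.sum_le_card {v ∈ near G u | G.Adj w v}
  have h3 := hx.sum_le_card {v ∈ far G u | G.Adj w v}
  have h4' : (#{v ∈ near G u | G.Adj w v} : ℝ) ≤ 4 := by exact_mod_cast h4
  have hx0 := hx.nonneg w
  unfold farLoss
  set a : ℝ := (#{v ∈ near G u | G.Adj w v} : ℝ)
  set b : ℝ := (#{v ∈ far G u | G.Adj w v} : ℝ)
  have ha : 0 ≤ a := Nat.cast_nonneg _
  have hb : 0 ≤ b := Nat.cast_nonneg _
  have h5 : a * (r * x w) ≤ 4 * (a + b) := by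
    have : a * (r * x w) ≤ a * (a + b) := mul_le_mul_of_nonneg_left (by linarith) ha
    have : a * (a + b) ≤ 4 * (a + b) := mul_le_mul_of_nonneg_right h4' (by linarith)
    linarith
  have h6 : 9 * (a * x w) ≤ a * (r * x w) := by
    have : 0 ≤ (r - 9) * (a * x w) := mul_nonneg (by linarith) (mul_nonneg ha hx0)
    linarith
  have h7 : 0 ≤ a * (1 - x w) := mul_nonneg ha (by linarith [hx.le_one w])
  linarith

theorem sum_far_adj_deep_le (hfree : (cyclePlus 5).Free G) (hr : 9 < r) {s : Finset V}
    (hs : ∀ v ∈ s, G.Adj u v ∧ IsDeep (link G u) v) :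
    ∑ v ∈ s, ∑ w ∈ far G u with G.Adj v w, x w ≤ 8 / 5 * ∑ w ∈ far G u, farLoss G u x w := by
  rw [sum_sum_adj, mul_sum]
  refine sum_le_sum fun w hw => ?_
  rcases Finset.eq_empty_or_nonempty {v ∈ s | G.Adj w v} with h | ⟨v, hv⟩
  · rw [h]
    have := hx.farLoss_nonneg w
    simp only [card_empty, Nat.cast_zero, zero_mul]
    positivity
  · rw [mem_filter] at hv
    refine le_trans (mul_le_mul_of_nonneg_right ?_ (hx.nonneg w))
      (hx.mul_le_farLoss hr hw (card_near_filter_adj_le_four hfree hw hv.2 (hs v hv.1).2))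
    exact_mod_cast card_le_card fun p hp => by
      rw [mem_filter] at hp ⊢
      exact ⟨mem_near.2 (hs p hp.1).1, hp.2⟩

/-- The set s is closed under link adjacency with degrees at most 3, so (r - 3) ∑ x is at most #s
plus the far contribution. Each charge is at least 1 - 2 x v, and r - 3 > 6. -/
theorem sum_charge_inFourCycle (hfree : (cyclePlus 5).Free G) (hr : 9 < r) {s : Finset V}
    (hs : ∀ v, v ∈ s ↔ G.Adj u v ∧ InFourCycle (link G u) v) :
    2 / 3 * (#s : ℝ) - (∑ v ∈ s, ∑ w ∈ far G u with G.Adj v w, x w) / 3 ≤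
      ∑ v ∈ s, charge (link G u) x v := by
  have hH := pathFiveFree_link (u := u) hfree
  have hnb : ∀ v ∈ s, (link G u).neighborFinset v = {w ∈ s | G.Adj v w} := by
    intro v hv
    ext w
    simp only [SimpleGraph.mem_neighborFinset, mem_filter, hs]
    have := (hs v).1 hv
    exact ⟨fun h => ⟨⟨h.2.2, this.2.adj hH h⟩, h.1⟩, fun h => ⟨h.2, this.1, h.1.1⟩⟩
  have hdeg : ∀ v ∈ s, (link G u).degree v = #{w ∈ s | G.Adj v w} := fun v hv => by
    rw [← hnb v hv, SimpleGraph.card_neighborFinset_eq_degree]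
  have h1 : ∑ v ∈ s, r * x v =
      #s + ∑ v ∈ s, ((link G u).degree v : ℝ) * x v +
        ∑ v ∈ s, ∑ w ∈ far G u with G.Adj v w, x w := by
    have h4 : ∀ v ∈ s, ((link G u).degree v : ℝ) * x v = (#{w ∈ s | G.Adj v w} : ℝ) * x v :=
      fun v hv => by rw [hdeg v hv]
    have h5 : ∀ v ∈ s, ∑ w ∈ (link G u).neighborFinset v, x w = ∑ w ∈ s with G.Adj v w, x w :=
      fun v hv => by rw [hnb v hv]
    rw [sum_congr rfl fun v hv => hx.eig_near ((hs v).1 hv).1, sum_add_distrib, sum_add_distrib,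
      sum_congr rfl h5, sum_congr rfl h4, sum_sum_adj]
    simp
  have h2 : ∑ v ∈ s, ((link G u).degree v : ℝ) * x v ≤ 3 * ∑ v ∈ s, x v := by
    rw [mul_sum]
    refine sum_le_sum fun v hv => mul_le_mul_of_nonneg_right ?_ (hx.nonneg v)
    exact_mod_cast ((hs v).1 hv).2.degree_le hH
  have h3 : (#s : ℝ) - 2 * ∑ v ∈ s, x v ≤ ∑ v ∈ s, charge (link G u) x v := by
    rw [mul_sum, card_eq_sum_ones, Nat.cast_sum, ← sum_sub_distrib]
    refine sum_le_sum fun v hv => ?_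
    have hc := ((hs v).1 hv).2
    have hd := hc.isDeep hH
    rw [charge_of_isDeep hd]
    have h2 : (2 : ℝ) ≤ (link G u).degree v := by exact_mod_cast hd.1
    have h3 : ((link G u).degree v : ℝ) ≤ 3 := by exact_mod_cast hc.degree_le hH
    have := hx.nonneg v
    push_cast
    nlinarith
  have h0 : 0 ≤ ∑ v ∈ s, x v := sum_nonneg fun v _ => hx.nonneg v
  rw [← mul_sum] at h1
  nlinarith

/-- Each vertex here has link degree 2 and charge 1 - x v. At least one of its neighbours is again
in s and the other has entry at most 1, so (r - 1) ∑ x is at most 2 #s plus the far contribution,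
and r - 1 > 8. -/
theorem sum_charge_triangle (hfree : (cyclePlus 5).Free G) (hr : 9 < r) {s : Finset V}
    (hs : ∀ v, v ∈ s ↔ G.Adj u v ∧ IsDeep (link G u) v ∧ ¬ InFourCycle (link G u) v)
    (hne : s.Nonempty) :
    3 / 4 * (#s : ℝ) - (∑ v ∈ s, ∑ w ∈ far G u with G.Adj v w, x w) / 8 <
      ∑ v ∈ s, charge (link G u) x v := by
  have hH := pathFiveFree_link (u := u) hfree
  have hdeg : ∀ v ∈ s, (link G u).degree v = 2 := by
    intro v hv
    have := (hs v).1 hv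
    obtain ⟨a, c, -, -, hac, hn⟩ := exists_triangle_of_isDeep hH this.2.1 this.2.2
    rw [← SimpleGraph.card_neighborFinset_eq_degree, hn, card_pair hac.ne]
  have h3 : ∑ v ∈ s, charge (link G u) x v = #s - ∑ v ∈ s, x v := by
    rw [card_eq_sum_ones, Nat.cast_sum, ← sum_sub_distrib]
    refine sum_congr rfl fun v hv => ?_
    rw [charge_of_isDeep ((hs v).1 hv).2.1, hdeg v hv]
    push_cast
    ring
  have hin : ∀ v ∈ s, {w ∈ (link G u).neighborFinset v | w ∈ s} = {w ∈ s | G.Adj v w} := by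
    intro v hv
    ext w
    simp only [SimpleGraph.mem_neighborFinset, mem_filter, link_adj]
    exact ⟨fun h => ⟨h.2, h.1.1⟩, fun h => ⟨⟨h.2, ((hs v).1 hv).1, ((hs w).1 h.1).1⟩, h.1⟩⟩
  have h2 : ∑ v ∈ s, ∑ w ∈ (link G u).neighborFinset v, x w ≤ #s + ∑ v ∈ s, x v := by
    have h4 : ∀ v ∈ s, ∑ w ∈ (link G u).neighborFinset v, x w ≤
        ∑ w ∈ s with G.Adj v w, x w + (2 - (#{w ∈ s | G.Adj v w} : ℝ)) := by
      intro v hv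
      rw [← sum_filter_add_sum_filter_not ((link G u).neighborFinset v) (· ∈ s), hin v hv]
      have h5 := hx.sum_le_card {w ∈ (link G u).neighborFinset v | w ∉ s}
      have h6 := card_filter_add_card_filter_not (s := (link G u).neighborFinset v) (· ∈ s)
      rw [hin v hv, SimpleGraph.card_neighborFinset_eq_degree, hdeg v hv] at h6
      have h7 : (#{w ∈ s | G.Adj v w} : ℝ) +
          (#{w ∈ (link G u).neighborFinset v | w ∉ s} : ℝ) = 2 := by exact_mod_cast h6
      linarith
    refine (sum_le_sum h4).trans ?_
    rw [sum_add_distrib, sum_sum_adj, card_eq_sum_ones, Nat.cast_sum, ← sum_add_distrib,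
      ← sum_add_distrib]
    refine sum_le_sum fun v hv => ?_
    have h8 : 1 ≤ #{w ∈ s | G.Adj v w} := by
      have := (hs v).1 hv
      obtain ⟨a, ha, hda, hca⟩ := exists_adj_isDeep_not_inFourCycle hH this.2.1 this.2.2
      exact card_pos.2 ⟨a, mem_filter.2 ⟨(hs a).2 ⟨ha.2.2, hda, hca⟩, ha.1⟩⟩
    have h9 : (1 : ℝ) ≤ #{w ∈ s | G.Adj v w} := by exact_mod_cast h8
    have := hx.le_one v
    push_cast
    nlinarith
  have h1 : ∑ v ∈ s, r * x v = #s + ∑ v ∈ s, ∑ w ∈ (link G u).neighborFinset v, x w +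
        ∑ v ∈ s, ∑ w ∈ far G u with G.Adj v w, x w := by
    rw [sum_congr rfl fun v hv => hx.eig_near ((hs v).1 hv).1, sum_add_distrib, sum_add_distrib]
    simp
  have h0 : 0 < ∑ v ∈ s, x v := by
    obtain ⟨v, hv⟩ := hne
    refine sum_pos' (fun v _ => hx.nonneg v) ⟨v, hv, ?_⟩
    have h5 := hx.eig_near ((hs v).1 hv).1
    have h6 : 0 ≤ ∑ w ∈ (link G u).neighborFinset v, x w := sum_nonneg fun v _ => hx.nonneg v
    have h7 : 0 ≤ ∑ w ∈ far G u with G.Adj v w, x w := sum_nonneg fun v _ => hx.nonneg v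
    by_contra! h
    nlinarith [hx.nonneg v]
  rw [← mul_sum] at h1
  nlinarith

theorem not_isDeep (hfree : (cyclePlus 5).Free G) (hr : 9 < r)
    (hm : (G.edgeSet.ncard : ℝ) - 3 / 2 ≤ r ^ 2 - r) (v : V) : ¬ IsDeep (link G u) v := by
  intro hv
  have hH := pathFiveFree_link (u := u) hfree
  have hvu : G.Adj u v := mem_near.1 (mem_near_of_degree_link_ne_zero v (by have := hv.1; omega))
  set A : Finset V := {v ∈ near G u | InFourCycle (link G u) v} with hA
  set B : Finset V := {v ∈ near G u | ¬ InFourCycle (link G u) v ∧ IsDeep (link G u) v} with hB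
  have hsA : ∀ v, v ∈ A ↔ G.Adj u v ∧ InFourCycle (link G u) v := by simp [hA]
  have hsB : ∀ v, v ∈ B ↔ G.Adj u v ∧ IsDeep (link G u) v ∧ ¬ InFourCycle (link G u) v := by
    intro v
    simp only [hB, mem_filter, mem_near]
    tauto
  have hAB : Disjoint A B := by
    rw [disjoint_left]
    intro v h1 h2
    exact ((hsB v).1 h2).2.2 ((hsA v).1 h1).2
  have hsum : ∑ v ∈ A, charge (link G u) x v + ∑ v ∈ B, charge (link G u) x v ≤
      ∑ v ∈ near G u, charge (link G u) x v := by
    rw [← sum_union hAB]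
    refine sum_le_sum_of_subset_of_nonneg (fun v hv => ?_) fun v hv hv' => ?_
    · rcases mem_union.1 hv with h | h
      · exact mem_near.2 ((hsA v).1 h).1
      · exact mem_near.2 ((hsB v).1 h).1
    · refine charge_nonneg hH (hx.nonneg v) (hx.le_one v) fun hd => hv' ?_
      rw [mem_union, hsA, hsB]
      have := mem_near.1 hv
      tauto
  have hX := hx.sum_far_adj_deep_le hfree hr (s := A ∪ B) fun v hv => by
    rcases mem_union.1 hv with h | h
    · exact ⟨((hsA v).1 h).1, ((hsA v).1 h).2.isDeep hH⟩
    · exact ⟨((hsB v).1 h).1, ((hsB v).1 h).2.1⟩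
  rw [sum_union hAB] at hX
  have hkey := hx.sq_sub_eq_sub_farLoss
  have hQ : 0 ≤ ∑ w ∈ far G u, farLoss G u x w := sum_nonneg fun w _ => hx.farLoss_nonneg w
  have hXA : 0 ≤ ∑ v ∈ A, ∑ w ∈ far G u with G.Adj v w, x w :=
    sum_nonneg fun _ _ => sum_nonneg fun w _ => hx.nonneg w
  have hXB : 0 ≤ ∑ v ∈ B, ∑ w ∈ far G u with G.Adj v w, x w :=
    sum_nonneg fun _ _ => sum_nonneg fun w _ => hx.nonneg w
  have hcA := hx.sum_charge_inFourCycle hfree hr hsA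
  have hB0 : 3 / 4 * (#B : ℝ) - (∑ v ∈ B, ∑ w ∈ far G u with G.Adj v w, x w) / 8 ≤
      ∑ v ∈ B, charge (link G u) x v := by
    rcases B.eq_empty_or_nonempty with h | h
    · simp [h]
    · exact (hx.sum_charge_triangle hfree hr hsB h).le
  have hA0 : (0 : ℝ) ≤ #A := Nat.cast_nonneg _
  have hB0' : (0 : ℝ) ≤ #B := Nat.cast_nonneg _
  by_cases hc : InFourCycle (link G u) v
  · have h4 : 3 ≤ #A := by
      obtain ⟨a, b, c, hva, hab, hbc, hcv, hvb, hac⟩ := hc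
      have hcv' : InFourCycle (link G u) v := ⟨a, b, c, hva, hab, hbc, hcv, hvb, hac⟩
      have hca := hcv'.adj hH hva
      exact two_lt_card.2 ⟨v, (hsA v).2 ⟨hva.2.1, hcv'⟩, a, (hsA a).2 ⟨hva.2.2, hca⟩,
        b, (hsA b).2 ⟨hab.2.2, hca.adj hH hab⟩, hva.ne, hvb, hab.ne⟩
    have h4' : (3 : ℝ) ≤ #A := by exact_mod_cast h4
    linarith
  · have hvB : v ∈ B := (hsB v).2 ⟨hvu, hv, hc⟩
    have hlt := hx.sum_charge_triangle hfree hr hsB ⟨v, hvB⟩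
    -- Two such vertices cost exactly 3/4 · 2 = 3/2 in the bound, so the strictness of
    -- `sum_charge_triangle` is needed.
    have h2 : 2 ≤ #B := by
      obtain ⟨a, ha, hda, hca⟩ := exists_adj_isDeep_not_inFourCycle hH hv hc
      exact one_lt_card.2 ⟨v, hvB, a, (hsB a).2 ⟨ha.2.2, hda, hca⟩, ha.ne⟩
    have h2' : (2 : ℝ) ≤ #B := by exact_mod_cast h2
    linarith

end IsPerron

end NoDeep

/-! ### One nontrivial component in the link -/

section Components

variable {V : Type*} [Fintype V] {H : SimpleGraph V} {N : Finset V} {x : V → ℝ}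

theorem exists_core_neighbor {v : V} (h : coreDegree H v ≠ 0) :
    ∃ y, H.Adj v y ∧ 2 ≤ H.degree y := by
  obtain ⟨y, hy⟩ := card_pos.1 (Nat.pos_of_ne_zero h)
  simp only [mem_filter, SimpleGraph.mem_neighborFinset] at hy
  exact ⟨y, hy.1, two_le_degree_of_ne_one hy.1.symm hy.2⟩

theorem half_le_charge (hH : PathFiveFree H) (hdeep : ∀ v, ¬ IsDeep H v) {v : V}
    (h1 : x v ≤ 1) (hv : 2 ≤ H.degree v) : 1 / 2 ≤ charge H x v := by
  have h2 := one_sub_le_charge hv h1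
  have h3 : (coreDegree H v : ℝ) ≤ 1 := by exact_mod_cast coreDegree_le_one (v := v) hH hdeep
  linarith

theorem half_le_charge_of_leaf {v p : V} (hv : H.degree v = 1) (hp : H.degree p = 1)
    (h : H.Adj v p) : 1 / 2 ≤ charge H x v := by
  rw [charge_of_degree_eq_one hv]
  have : (1 : ℝ) ≤ leafDegree H v := by exact_mod_cast leafDegree_pos h hp
  linarith

/-- If all degrees were at most one, every entry would be at most twice its charge, making the
entries sum to at most 3. -/
theorem exists_two_le_degree (h0 : ∀ v, 0 ≤ x v) (h1 : ∀ v, x v ≤ 1)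
    (hsum : ∑ v ∈ N, charge H x v ≤ 3 / 2) (hlarge : 3 < ∑ v ∈ N, x v) :
    ∃ b, 2 ≤ H.degree b := by
  by_contra! h
  have : ∑ v ∈ N, x v ≤ ∑ v ∈ N, 2 * charge H x v := by
    refine sum_le_sum fun v hv => ?_
    have := h v
    interval_cases hd : H.degree v
    · rw [charge_of_degree_eq_zero hd]
      linarith [h0 v]
    · obtain ⟨p, hp⟩ := (H.degree_pos_iff_exists_adj v).1 (by omega)
      have := half_le_charge_of_leaf (x := x) hd
        (by have := degree_pos_of_adj hp.symm; have := h p; omega) hp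
      have := h1 v
      linarith
  rw [← mul_sum] at this
  linarith

variable (hH : PathFiveFree H) (hdeep : ∀ v, ¬ IsDeep H v) (hN : ∀ v, H.degree v ≠ 0 → v ∈ N)
  (h0 : ∀ v, 0 ≤ x v) (h1 : ∀ v, x v ≤ 1)
include hH hdeep hN h0 h1

theorem sum_charge_add_le {T s : Finset V} (hsum : ∑ v ∈ N, charge H x v ≤ 3 / 2)
    (hTN : ∀ t ∈ T, H.degree t ≠ 0) (hsN : ∀ t ∈ s, H.degree t ≠ 0) (hTs : Disjoint T s) :
    ∑ v ∈ T, charge H x v + ∑ v ∈ s, charge H x v ≤ 3 / 2 := by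
  rw [← sum_union hTs]
  refine le_trans (sum_le_sum_of_subset_of_nonneg (fun v hv => ?_) fun v _ _ =>
    charge_nonneg hH (h0 v) (h1 v) (hdeep v)) hsum
  rcases mem_union.1 hv with h | h
  · exact hN v (hTN v h)
  · exact hN v (hsN v h)

/-- T is a component's core and uses 1 of the budget 3/2. A second core would cost another 1: a star
centre alone, or 1/2 for each of two adjacent core vertices. -/
theorem degree_lt_two_of_notMem {T : Finset V} (hsum : ∑ v ∈ N, charge H x v ≤ 3 / 2)
    (hT : ∀ t ∈ T, 2 ≤ H.degree t) (hTc : ∀ t ∈ T, ∀ y, H.Adj t y → 2 ≤ H.degree y → y ∈ T)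
    (hTsum : 1 ≤ ∑ v ∈ T, charge H x v) {z : V} (hz : z ∉ T) : H.degree z < 2 := by
  by_contra! hz2
  have hTN : ∀ t ∈ T, H.degree t ≠ 0 := fun t ht => by have := hT t ht; omega
  by_cases hk : coreDegree H z = 0
  · have h2 := sum_charge_add_le hH hdeep hN h0 h1 (T := T) (s := {z}) hsum hTN
      (fun t ht => by rw [mem_singleton.1 ht]; omega) (by simpa using hz)
    have h3 := one_sub_le_charge hz2 (h1 z)
    rw [hk] at h3
    rw [sum_singleton] at h2
    norm_num at h3
    linarith
  · obtain ⟨y, hy, hy2⟩ := exists_core_neighbor hk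
    have hyT : y ∉ T := fun h => hz (hTc y h z hy.symm hz2)
    have h2 := sum_charge_add_le hH hdeep hN h0 h1 (T := T) (s := {z, y}) hsum hTN
      (fun t ht => by
        rcases mem_insert.1 ht with rfl | h
        · omega
        · rw [mem_singleton.1 h]; omega) (by simp [hz, hyT])
    rw [sum_pair hy.ne] at h2
    have := half_le_charge hH hdeep (h1 z) hz2
    have := half_le_charge hH hdeep (h1 y) hy2
    linarith

/-- An edge avoiding T would be an isolated edge, whose two ends cost 1/2 each. -/
theorem mem_of_adj_of_notMem {T : Finset V} (hsum : ∑ v ∈ N, charge H x v ≤ 3 / 2)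
    (hT : ∀ t ∈ T, 2 ≤ H.degree t) (hTc : ∀ t ∈ T, ∀ y, H.Adj t y → 2 ≤ H.degree y → y ∈ T)
    (hTsum : 1 ≤ ∑ v ∈ T, charge H x v) {z y : V} (hz : z ∉ T) (hzy : H.Adj z y) : y ∈ T := by
  by_contra hy
  have hz2 := degree_lt_two_of_notMem hH hdeep hN h0 h1 hsum hT hTc hTsum hz
  have hy2 := degree_lt_two_of_notMem hH hdeep hN h0 h1 hsum hT hTc hTsum hy
  have hz0 := degree_pos_of_adj hzy
  have hy0 := degree_pos_of_adj hzy.symm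
  have h2 := sum_charge_add_le hH hdeep hN h0 h1 (T := T) (s := {z, y}) hsum
    (fun t ht => by have := hT t ht; omega)
    (fun t ht => by
      rcases mem_insert.1 ht with rfl | h
      · omega
      · rw [mem_singleton.1 h]; omega) (by simp [hz, hy])
  rw [sum_pair hzy.ne] at h2
  have := half_le_charge_of_leaf (x := x) (by omega) (by omega) hzy
  have := half_le_charge_of_leaf (x := x) (by omega) (by omega) hzy.symm
  linarith

theorem sum_isolated_le {T : Finset V} (hT : ∀ t ∈ T, 2 ≤ H.degree t) :
    ∑ v ∈ T, charge H x v + ∑ v ∈ N with H.degree v = 0, x v ≤ ∑ v ∈ N, charge H x v := by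
  have h2 : ∑ v ∈ N with H.degree v = 0, x v = ∑ v ∈ N with H.degree v = 0, charge H x v :=
    sum_congr rfl fun v hv => (charge_of_degree_eq_zero (mem_filter.1 hv).2).symm
  rw [h2, ← sum_union]
  · refine sum_le_sum_of_subset_of_nonneg (fun v hv => ?_) fun v _ _ =>
      charge_nonneg hH (h0 v) (h1 v) (hdeep v)
    rcases mem_union.1 hv with h | h
    · exact hN v (by have := hT v h; omega)
    · exact (mem_filter.1 h).1
  · rw [disjoint_left]
    intro v hv h
    have := hT v hv
    have := (mem_filter.1 h).2
    omega

/-- Up to isolated vertices, `H` is a star or a double star. -/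
theorem star_or_doubleStar (hsum : ∑ v ∈ N, charge H x v ≤ 3 / 2)
    (hlarge : 3 < ∑ v ∈ N, x v) :
    (∃ b, 2 ≤ H.degree b ∧ coreDegree H b = 0 ∧
      ∀ z, z ≠ b → H.degree z < 2 ∧ ∀ y, H.Adj z y → y = b) ∨
    (∃ b c, H.Adj b c ∧ 2 ≤ H.degree b ∧ 2 ≤ H.degree c ∧ coreDegree H b = 1 ∧
      coreDegree H c = 1 ∧
      ∀ z, z ≠ b → z ≠ c → H.degree z < 2 ∧ ∀ y, H.Adj z y → y = b ∨ y = c) := by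
  obtain ⟨b, hb⟩ := exists_two_le_degree h0 h1 hsum hlarge
  by_cases hk : coreDegree H b = 0
  · refine Or.inl ⟨b, hb, hk, fun z hz => ?_⟩
    have hT : ∀ t ∈ ({b} : Finset V), 2 ≤ H.degree t := by simpa using hb
    have hTc : ∀ t ∈ ({b} : Finset V), ∀ y, H.Adj t y → 2 ≤ H.degree y → y ∈ ({b} : Finset V) := by
      intro t ht y hy hy2
      rw [mem_singleton.1 ht] at hy
      unfold coreDegree at hk
      rw [card_eq_zero, filter_eq_empty_iff] at hk
      exact (hk ((H.mem_neighborFinset _ _).2 hy) (by omega)).elim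
    have hTsum : 1 ≤ ∑ v ∈ ({b} : Finset V), charge H x v := by
      have := one_sub_le_charge hb (h1 b)
      rw [hk] at this
      simpa using this
    have hz' : z ∉ ({b} : Finset V) := by simpa using hz
    exact ⟨degree_lt_two_of_notMem hH hdeep hN h0 h1 hsum hT hTc hTsum hz', fun y hy =>
      mem_singleton.1 (mem_of_adj_of_notMem hH hdeep hN h0 h1 hsum hT hTc hTsum hz' hy)⟩
  · obtain ⟨c, hbc, hc⟩ := exists_core_neighbor hk
    have hkc : coreDegree H c ≠ 0 :=
      (card_pos.2 ⟨b, by simp only [mem_filter, SimpleGraph.mem_neighborFinset]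
                         exact ⟨hbc.symm, by omega⟩⟩).ne'
    have hkb1 := coreDegree_le_one (v := b) hH hdeep
    have hkc1 := coreDegree_le_one (v := c) hH hdeep
    refine Or.inr ⟨b, c, hbc, hb, hc, by omega, by omega, fun z hzb hzc => ?_⟩
    have huniq : ∀ v w y, coreDegree H v ≤ 1 → H.Adj v w → 2 ≤ H.degree w → H.Adj v y →
        2 ≤ H.degree y → y = w := by
      intro v w y hv hw hw2 hy hy2
      refine card_le_one.1 hv y ?_ w ?_ <;>
        simp only [mem_filter, SimpleGraph.mem_neighborFinset]
      · exact ⟨hy, by omega⟩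
      · exact ⟨hw, by omega⟩
    have hT : ∀ t ∈ ({b, c} : Finset V), 2 ≤ H.degree t := by simp [hb, hc]
    have hTc : ∀ t ∈ ({b, c} : Finset V), ∀ y, H.Adj t y → 2 ≤ H.degree y →
        y ∈ ({b, c} : Finset V) := by
      intro t ht y hy hy2
      simp only [mem_insert, mem_singleton] at ht ⊢
      rcases ht with rfl | rfl
      · exact Or.inr (huniq t c y hkb1 hbc hc hy hy2)
      · exact Or.inl (huniq t b y hkc1 hbc.symm hb hy hy2)
    have hTsum : 1 ≤ ∑ v ∈ ({b, c} : Finset V), charge H x v := by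
      rw [sum_pair hbc.ne]
      have := half_le_charge hH hdeep (h1 b) hb
      have := half_le_charge hH hdeep (h1 c) hc
      linarith
    have hz' : z ∉ ({b, c} : Finset V) := by simp [hzb, hzc]
    refine ⟨degree_lt_two_of_notMem hH hdeep hN h0 h1 hsum hT hTc hTsum hz', fun y hy => ?_⟩
    have := mem_of_adj_of_notMem hH hdeep hN h0 h1 hsum hT hTc hTsum hz' hy
    simpa using this

end Components

/-! ### No vertex lies outside the closed neighbourhood -/

section Far

variable {V : Type*} [Fintype V] {G : SimpleGraph V} {u : V} {x : V → ℝ} {r : ℝ}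

/-- A far vertex loses more than 1/2: by an edge to another far vertex, or because its entry is
small. The exceptional vertex b allows for a star centre, which starts no two-edge path in the link.
-/
theorem IsPerron.far_eq_empty (hx : IsPerron G u x r) (hfree : (cyclePlus 5).Free G) (hr : 9 < r)
    (hiso : ∀ v : V, ¬ G.IsIsolated v) (b : V)
    (hb : ∀ a, (link G u).degree a ≠ 0 → a = b ∨
      ∃ c c', (link G u).Adj a c ∧ (link G u).Adj c c' ∧ a ≠ c')
    (hle : ∑ v ∈ near G u with (link G u).degree v = 0, x v +
      ∑ w ∈ far G u, farLoss G u x w ≤ 1 / 2) : far G u = ∅ := by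
  rw [eq_empty_iff_forall_notMem]
  intro w hw
  obtain ⟨hwu, hwu'⟩ := mem_far.1 hw
  have hI : 0 ≤ ∑ v ∈ near G u with (link G u).degree v = 0, x v :=
    sum_nonneg fun v _ => hx.nonneg v
  have hQ : 0 ≤ ∑ w ∈ far G u, farLoss G u x w := sum_nonneg fun w _ => hx.farLoss_nonneg w
  have hqw : farLoss G u x w ≤ ∑ w ∈ far G u, farLoss G u x w :=
    single_le_sum (fun w _ => hx.farLoss_nonneg w) hw
  have hhalf : ∀ v, (#{y ∈ far G u | G.Adj v y} : ℝ) / 2 ≤ farLoss G u x v := by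
    intro v
    have : 0 ≤ (#{y ∈ near G u | G.Adj v y} : ℝ) * (1 - x v) :=
      mul_nonneg (Nat.cast_nonneg _) (by linarith [hx.le_one v])
    unfold farLoss
    linarith
  have hff : ∀ y ∈ far G u, ¬ G.Adj w y := by
    intro y hy hwy
    have h1 : (1 : ℝ) ≤ #{y ∈ far G u | G.Adj w y} := by
      exact_mod_cast card_pos.2 ⟨y, mem_filter.2 ⟨hy, hwy⟩⟩
    have h2 : (1 : ℝ) ≤ #{z ∈ far G u | G.Adj y z} := by
      exact_mod_cast card_pos.2 ⟨w, mem_filter.2 ⟨hw, hwy.symm⟩⟩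
    have h3 : ∑ v ∈ {w, y}, farLoss G u x v ≤ ∑ w ∈ far G u, farLoss G u x w :=
      sum_le_sum_of_subset_of_nonneg (by simp [insert_subset_iff, hw, hy, -mem_far])
        fun v _ _ => hx.farLoss_nonneg v
    rw [sum_pair hwy.ne] at h3
    have := hhalf w
    have := hhalf y
    linarith
  have heig := hx.eig_far hw
  have hempty : ({y ∈ far G u | G.Adj w y} : Finset V) = ∅ := filter_eq_empty_iff.2 hff
  have hq : farLoss G u x w = (#{v ∈ near G u | G.Adj w v} : ℝ) * (1 - x w) := by
    simp [farLoss, hempty]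
  rw [hempty, sum_empty, add_zero] at heig
  have hcard := hx.sum_le_card {v ∈ near G u | G.Adj w v}
  have hpos : 1 ≤ #{v ∈ near G u | G.Adj w v} := by
    have := hiso w
    rw [SimpleGraph.IsIsolated] at this
    push Not at this
    obtain ⟨y, hy⟩ := this
    refine card_pos.2 ⟨y, mem_filter.2 ⟨?_, hy⟩⟩
    by_contra hyN
    refine hff y (mem_far.2 ⟨?_, by simpa using hyN⟩) hy
    rintro rfl
    exact hwu' hy.symm
  have hpos' : (1 : ℝ) ≤ #{v ∈ near G u | G.Adj w v} := by exact_mod_cast hpos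
  have hx0 := hx.nonneg w
  rcases le_or_gt #{v ∈ near G u | G.Adj w v} 4 with h4 | h4
  · have h4' : (#{v ∈ near G u | G.Adj w v} : ℝ) ≤ 4 := by exact_mod_cast h4
    have h5 : 9 * x w ≤ 4 := by nlinarith
    nlinarith
  -- With five or more near neighbours, w cannot see the start a of a path a, c, c' in the link: c,
  -- u, p, w, a with apex c' would be a C_5^+. So w sees only b and isolated link vertices, of total
  -- weight at most 3/2.
  · have hsub : ∑ v ∈ near G u with G.Adj w v, x v ≤
        1 + ∑ v ∈ near G u with (link G u).degree v = 0, x v := by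
      have h6 : ∑ v ∈ near G u with G.Adj w v, x v ≤
          ∑ v ∈ insert b {v ∈ near G u | (link G u).degree v = 0}, x v := by
        refine sum_le_sum_of_subset_of_nonneg (fun a ha => ?_) fun v _ _ => hx.nonneg v
        rw [mem_filter] at ha
        rw [mem_insert, mem_filter]
        by_contra! hcon
        rcases hb a (hcon.2 ha.1) with h | ⟨c, c', hac, hcc, hac'⟩
        · exact hcon.1 h
        obtain ⟨p, hp, hp'⟩ : ∃ p ∈ ({v ∈ near G u | G.Adj w v} : Finset V),
            p ∉ ({a, c, c'} : Finset V) :=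
          exists_mem_notMem_of_card_lt_card (card_le_three.trans_lt (by omega))
        simp only [mem_filter, mem_near] at hp
        simp only [mem_insert, mem_singleton, not_or] at hp'
        have hwN : ∀ a, G.Adj u a → w ≠ a := by
          rintro a ha rfl
          exact hwu' ha
        exact false_of_cyclePlus_five hfree (a := c) (b := u) (c := p) (d := w) (e := a)
          (t := c') hac.2.2.symm hp.1 hp.2.symm ha.2 hac.1 hcc.1.symm hcc.2.2.symm
          (Ne.symm hp'.2.1) (hwN c hac.2.2).symm hwu.symm hac.2.1.ne hp'.1 (Ne.symm hp'.2.2)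
          (hwN c' hcc.2.2).symm hac'.symm
      have h7 : ∑ v ∈ insert b {v ∈ near G u | (link G u).degree v = 0}, x v ≤
          x b + ∑ v ∈ near G u with (link G u).degree v = 0, x v := by
        by_cases hbI : b ∈ ({v ∈ near G u | (link G u).degree v = 0} : Finset V)
        · rw [insert_eq_of_mem hbI]
          linarith [hx.nonneg b]
        · rw [sum_insert hbI]
      linarith [hx.le_one b]
    have h5 : 9 * x w ≤ 3 / 2 := by nlinarith
    nlinarith

end Far

/-! ### The star gives the extremal graph; the double star is impossible -/

section Final

variable {V : Type*} [Fintype V] {G : SimpleGraph V} {u : V} {x : V → ℝ} {r : ℝ}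

variable (G u) in
/-- The neighbours of `u` that have no common neighbour with `u`. -/
noncomputable def lonely : Finset V := {v ∈ near G u | (link G u).degree v = 0}

theorem mem_lonely {v : V} : v ∈ lonely G u ↔ G.Adj u v ∧ (link G u).degree v = 0 := by
  simp [lonely]

theorem degree_eq_one_of_adj {H : SimpleGraph V} {z y : V} (h2 : H.degree z < 2)
    (h : H.Adj z y) : H.degree z = 1 := by
  have := degree_pos_of_adj h
  omega

theorem IsPerron.sum_lonely (hx : IsPerron G u x r) (hr : 9 < r) (hfar : far G u = ∅) :
    ∑ v ∈ lonely G u, x v = #(lonely G u) / r := by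
  have h : ∀ v ∈ lonely G u, x v = 1 / r := by
    intro v hv
    obtain ⟨hv, hv0⟩ := mem_lonely.1 hv
    have h1 := hx.eig_near hv
    rw [← SimpleGraph.card_neighborFinset_eq_degree, card_eq_zero] at hv0
    rw [hfar, hv0] at h1
    simp only [sum_empty, filter_empty, add_zero] at h1
    field_simp
    linarith
  rw [sum_congr rfl h, sum_const, nsmul_eq_mul]
  ring

theorem sum_near_star {b : V} (hb : 2 ≤ (link G u).degree b)
    (hz : ∀ z, z ≠ b → (link G u).degree z < 2 ∧ ∀ y, (link G u).Adj z y → y = b) (f : V → ℝ) :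
    ∑ v ∈ near G u, f v =
      f b + ∑ v ∈ (link G u).neighborFinset b, f v + ∑ v ∈ lonely G u, f v := by
  have hbN := mem_near.1 (mem_near_of_degree_link_ne_zero (G := G) (u := u) b (by omega))
  have h : near G u = insert b ((link G u).neighborFinset b ∪ lonely G u) := by
    ext v
    simp only [mem_near, mem_insert, mem_union, SimpleGraph.mem_neighborFinset, mem_lonely]
    constructor
    · intro hv
      by_cases h0 : (link G u).degree v = 0
      · exact Or.inr (Or.inr ⟨hv, h0⟩)
      by_cases hvb : v = b
      · exact Or.inl hvb
      obtain ⟨y, hy⟩ := ((link G u).degree_pos_iff_exists_adj v).1 (Nat.pos_of_ne_zero h0)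
      have := (hz v hvb).2 y hy
      exact Or.inr (Or.inl (this ▸ hy.symm))
    · rintro (rfl | h | h)
      · exact hbN
      · exact h.2.2
      · exact h.1
  have hd : Disjoint ((link G u).neighborFinset b) (lonely G u) := by
    rw [disjoint_left]
    intro v hv hv'
    rw [SimpleGraph.mem_neighborFinset] at hv
    exact (degree_pos_of_adj hv.symm).ne' (mem_lonely.1 hv').2
  have hbn : b ∉ (link G u).neighborFinset b ∪ lonely G u := by
    simp only [mem_union, SimpleGraph.mem_neighborFinset, mem_lonely, SimpleGraph.irrefl, false_or,
      not_and]
    intro _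
    omega
  rw [h, sum_insert hbn, sum_union hd, add_assoc]

theorem IsPerron.isSplitMinus_of_star (hx : IsPerron G u x r) (hr : 9 < r)
    (hfar : far G u = ∅) (hm : Even G.edgeSet.ncard) {b : V} (hb : 2 ≤ (link G u).degree b)
    (hz : ∀ z, z ≠ b → (link G u).degree z < 2 ∧ ∀ y, (link G u).Adj z y → y = b)
    (hle : ((link G u).degree b - 1) * (1 - x b) + ∑ v ∈ lonely G u, x v ≤ 1 / 2) :
    ∃ i, IsSplitMinus G u b i ∧ 2 * Fintype.card V = G.edgeSet.ncard + 4 := by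
  have hsum := sum_near_star hb hz
  have hbN := mem_near.1 (mem_near_of_degree_link_ne_zero (G := G) (u := u) b (by omega))
  have hleaf : ∀ v ∈ (link G u).neighborFinset b, (link G u).degree v = 1 := fun v hv => by
    rw [SimpleGraph.mem_neighborFinset] at hv
    exact degree_eq_one_of_adj (hz v hv.ne.symm).1 hv.symm
  have hlon : ∀ v ∈ lonely G u, (link G u).degree v = 0 := fun v hv => (mem_lonely.1 hv).2
  have hI := hx.sum_lonely hr hfar
  have hcard : (#(near G u) : ℝ) = 1 + (link G u).degree b + #(lonely G u) := by
    have := hsum (fun _ => 1)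
    simpa using this
  have hdeg : ∑ v ∈ near G u, ((link G u).degree v : ℝ) = 2 * (link G u).degree b := by
    rw [hsum, sum_congr rfl fun v hv => by rw [hleaf v hv],
      sum_congr (s₁ := lonely G u) rfl fun v hv => by rw [hlon v hv]]
    simp
    ring
  have hdegx : ∑ v ∈ near G u, ((link G u).degree v : ℝ) * x v =
      (link G u).degree b * x b + ∑ v ∈ (link G u).neighborFinset b, x v := by
    rw [hsum, sum_congr rfl fun v hv => by rw [hleaf v hv],
      sum_congr (s₁ := lonely G u) rfl fun v hv => by rw [hlon v hv]]
    simp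
  have hedge := ncard_edgeSet_eq (G := G) (u := u)
  rw [hfar, hcard, hdeg] at hedge
  have hmk : G.edgeSet.ncard = 1 + 2 * (link G u).degree b + #(lonely G u) := by
    simp only [sum_empty] at hedge
    have : (G.edgeSet.ncard : ℝ) = ((1 + 2 * (link G u).degree b + #(lonely G u) : ℕ) : ℝ) := by
      rw [hedge]
      push_cast
      ring
    exact_mod_cast this
  have hxb := hx.eig_near hbN
  have hsq := hx.sq_eq
  have hxs := hx.sum_near
  rw [hfar] at hxb hsq
  rw [hsum] at hxs
  rw [hdegx, hcard] at hsq
  simp only [sum_empty, filter_empty, add_zero] at hxb hsq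
  have hxb1 := hx.le_one b
  have hk : #(lonely G u) = 1 := by
    by_contra hk1
    -- By `hmk`, evenness of the number of edges makes the number of lonely vertices odd, hence
    -- nonzero.
    have hk2 : 2 ≤ #(lonely G u) := by
      rcases hm with ⟨t, ht⟩
      omega
    have hk2' : (2 : ℝ) ≤ #(lonely G u) := by exact_mod_cast hk2
    have hd2 : (2 : ℝ) ≤ (link G u).degree b := by exact_mod_cast hb
    rw [hI] at hle hxs
    set k : ℝ := ((#(lonely G u) : ℕ) : ℝ)
    set d : ℝ := (((link G u).degree b : ℕ) : ℝ)
    have hδ : (r + 1) * (1 - x b) = k / r := by linarith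
    have hkr : k / r * r = k := div_mul_cancel₀ _ (by linarith)
    have h1 : r ^ 2 - r ≤ 2 * d + k := by nlinarith
    have h2 : ((d - 1) * (1 - x b) + k / r) * (r * (r + 1)) = (d - 1) * k + k * (r + 1) := by
      have : ((d - 1) * (1 - x b) + k / r) * (r * (r + 1)) =
        (d - 1) * ((r + 1) * (1 - x b)) * r + (k / r * r) * (r + 1) := by ring
      rw [this, hδ, hkr, mul_assoc, hkr]
    have h3 : (d - 1) * k + k * (r + 1) ≤ 1 / 2 * (r * (r + 1)) := by
      rw [← h2]
      exact mul_le_mul_of_nonneg_right hle (by nlinarith)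
    -- Here k (d + r) ≤ r (r + 1) / 2 and 2 d ≥ r² - r - k, so k (r² + r - k) ≤ r² + r. This fails
    -- for 2 ≤ k ≤ r / 2, the upper bound coming from k / r ≤ 1/2.
    nlinarith
  obtain ⟨i, hi⟩ := card_eq_one.1 hk
  have hiI : i ∈ lonely G u := by simp [hi]
  obtain ⟨hui, hi0⟩ := mem_lonely.1 hiI
  have hbi : b ≠ i := by
    rintro rfl
    omega
  have hall : ∀ v, v = u ∨ G.Adj u v := by
    intro v
    by_contra! h
    have : v ∈ far G u := mem_far.2 h
    simp [hfar] at this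
  have hiAdj : ∀ y, ¬ (link G u).Adj i y := fun y hy => (degree_pos_of_adj hy).ne' hi0
  have hbAdj : ∀ v, v ≠ u → v ≠ b → v ≠ i → (link G u).Adj v b := by
    intro v hvu hvb hvi
    have hv := (hall v).resolve_left hvu
    have h0 : (link G u).degree v ≠ 0 := fun h => hvi (by
      have : v ∈ lonely G u := mem_lonely.2 ⟨hv, h⟩
      simpa [hi] using this)
    obtain ⟨y, hy⟩ := ((link G u).degree_pos_iff_exists_adj v).1 (Nat.pos_of_ne_zero h0)
    exact (hz v hvb).2 y hy ▸ hy
  refine ⟨i, ⟨hbN.ne, hui.ne, hbi, fun v w => ?_⟩, ?_⟩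
  · constructor
    · intro h
      refine ⟨h.ne, ?_⟩
      by_cases hvu : v = u
      · exact Or.inl hvu
      by_cases hwu : w = u
      · exact Or.inr (Or.inl hwu)
      have hvw : (link G u).Adj v w := ⟨h, (hall v).resolve_left hvu, (hall w).resolve_left hwu⟩
      refine Or.inr (Or.inr ⟨?_, ?_, ?_⟩)
      · by_cases hvb : v = b
        · exact Or.inl hvb
        · exact Or.inr ((hz v hvb).2 w hvw)
      · rintro rfl
        exact hiAdj w hvw
      · rintro rfl
        exact hiAdj v hvw.symm
    · rintro ⟨hne, rfl | rfl | ⟨rfl | rfl, h1, h2⟩⟩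
      · exact (hall w).resolve_left hne.symm
      · exact ((hall v).resolve_left hne).symm
      · by_cases hwu : w = u
        · exact hwu ▸ hbN.symm
        · exact (hbAdj w hwu hne.symm h2).1.symm
      · by_cases hvu : v = u
        · exact hvu ▸ hbN
        · exact (hbAdj v hvu hne h1).1
  · have hV := sum_univ_eq_near_far (G := G) (u := u) (fun _ => 1)
    rw [hfar] at hV
    simp only [sum_const, card_univ, nsmul_eq_mul, mul_one, card_empty, Nat.cast_zero,
      add_zero, hcard, hk] at hV
    have hV' : Fintype.card V = (link G u).degree b + 3 := by
      have : (Fintype.card V : ℝ) = (((link G u).degree b + 3 : ℕ) : ℝ) := by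
        rw [hV]
        push_cast
        ring
      exact_mod_cast this
    omega

theorem sum_near_doubleStar {b c : V} (hbc : (link G u).Adj b c)
    (hz : ∀ z, z ≠ b → z ≠ c → (link G u).degree z < 2 ∧
      ∀ y, (link G u).Adj z y → y = b ∨ y = c) (f : V → ℝ) :
    ∑ v ∈ near G u, f v = f b + f c + ∑ v ∈ ((link G u).neighborFinset b).erase c, f v +
      ∑ v ∈ ((link G u).neighborFinset c).erase b, f v + ∑ v ∈ lonely G u, f v := by
  have hleaf : ∀ z, z ≠ b → z ≠ c → (link G u).Adj z b → (link G u).Adj z c → False := by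
    intro z h1 h2 h3 h4
    exact hbc.ne (eq_of_degree_eq_one (degree_eq_one_of_adj (hz z h1 h2).1 h3) h3 h4)
  have h : near G u = insert b (insert c ((((link G u).neighborFinset b).erase c ∪
      ((link G u).neighborFinset c).erase b) ∪ lonely G u)) := by
    ext v
    simp only [mem_near, mem_insert, mem_union, mem_erase, SimpleGraph.mem_neighborFinset,
      mem_lonely]
    constructor
    · intro hv
      by_cases h0 : (link G u).degree v = 0
      · exact Or.inr (Or.inr (Or.inr ⟨hv, h0⟩))
      by_cases hvb : v = b
      · exact Or.inl hvb
      by_cases hvc : v = c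
      · exact Or.inr (Or.inl hvc)
      obtain ⟨y, hy⟩ := ((link G u).degree_pos_iff_exists_adj v).1 (Nat.pos_of_ne_zero h0)
      rcases (hz v hvb hvc).2 y hy with rfl | rfl
      · exact Or.inr (Or.inr (Or.inl (Or.inl ⟨hvc, hy.symm⟩)))
      · exact Or.inr (Or.inr (Or.inl (Or.inr ⟨hvb, hy.symm⟩)))
    · rintro (rfl | rfl | (⟨-, h⟩ | ⟨-, h⟩) | h)
      · exact hbc.2.1
      · exact hbc.2.2
      · exact h.2.2
      · exact h.2.2
      · exact h.1
  have hlon : ∀ {v w}, (link G u).Adj v w → ¬ (G.Adj u v ∧ (link G u).degree v = 0) :=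
    fun h h' => (degree_pos_of_adj h).ne' h'.2
  have hd : Disjoint (((link G u).neighborFinset b).erase c ∪
      ((link G u).neighborFinset c).erase b) (lonely G u) := by
    rw [disjoint_left]
    intro v hv hv'
    simp only [mem_union, mem_erase, SimpleGraph.mem_neighborFinset] at hv
    rcases hv with h | h
    · exact hlon h.2.symm (mem_lonely.1 hv')
    · exact hlon h.2.symm (mem_lonely.1 hv')
  have hd' : Disjoint (((link G u).neighborFinset b).erase c)
      (((link G u).neighborFinset c).erase b) := by
    rw [disjoint_left]
    intro v hv hv'
    simp only [mem_erase, SimpleGraph.mem_neighborFinset] at hv hv'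
    exact hleaf v hv'.1 hv.1 hv.2.symm hv'.2.symm
  have hbn : b ∉ insert c ((((link G u).neighborFinset b).erase c ∪
      ((link G u).neighborFinset c).erase b) ∪ lonely G u) := by
    simp only [mem_insert, mem_union, mem_erase, SimpleGraph.mem_neighborFinset, mem_lonely]
    have := hbc.ne
    have := hlon hbc
    have := (link G u).irrefl (v := b)
    tauto
  have hcn : c ∉ (((link G u).neighborFinset b).erase c ∪
      ((link G u).neighborFinset c).erase b) ∪ lonely G u := by
    simp only [mem_union, mem_erase, SimpleGraph.mem_neighborFinset, mem_lonely]
    have := hlon hbc.symm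
    have := (link G u).irrefl (v := c)
    tauto
  rw [h, sum_insert hbn, sum_insert hcn, sum_union hd, sum_union hd']
  ring

/-- Here y, z are the entries at the two centres, s, t their numbers of leaves, β, γ the leaf sums
and k the number of lonely vertices. The leaves at one centre lower the entry at the other, so the
loss bounds s t by r (r + 1) / 4. But s + t - 1 ≤ s t, while the formula for r² makes s + t about r²
/ 2. -/
theorem doubleStar_arith {r k s t β γ y z : ℝ} (hr : 9 < r) (hk : 0 ≤ k) (hs : 1 ≤ s)
    (ht : 1 ≤ t) (hy1 : y ≤ 1) (hz1 : z ≤ 1) (hβ : s ≤ r * β) (hγ : t ≤ r * γ)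
    (hy : r * y = 1 + β + z) (hz : r * z = 1 + γ + y) (hsum : y + z + β + γ + k / r = r)
    (hle : s * (1 - y) + t * (1 - z) + k / r ≤ 1 / 2)
    (hsq : r ^ 2 = 2 + s + t + k + (s + 1) * y + (t + 1) * z + β + γ) : False := by
  have hr0 : 0 < r := by linarith
  have hkr0 : 0 ≤ k / r := by positivity
  have hrk : 0 ≤ r * (k / r) := by positivity
  have hty : t ≤ r * (r + 1) * (1 - y) := by
    have h : (r + 1) * (1 - y) = γ + k / r := by linarith
    rw [mul_assoc, h, mul_add]
    linarith
  have hsz : s ≤ r * (r + 1) * (1 - z) := by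
    have h : (r + 1) * (1 - z) = β + k / r := by linarith
    rw [mul_assoc, h, mul_add]
    linarith
  have hy0 : 0 ≤ s * (1 - y) := mul_nonneg (by linarith) (by linarith)
  have hz0 : 0 ≤ t * (1 - z) := mul_nonneg (by linarith) (by linarith)
  have hk2 : k ≤ 1 / 2 * r := by
    rw [← div_le_iff₀ hr0]
    linarith
  have hst : 2 * (s * t) ≤ 1 / 2 * (r * (r + 1)) := by
    have h1 : s * t ≤ s * (r * (r + 1) * (1 - y)) := mul_le_mul_of_nonneg_left hty (by linarith)
    have h2 : t * s ≤ t * (r * (r + 1) * (1 - z)) := mul_le_mul_of_nonneg_left hsz (by linarith)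
    have h3 : (s * (1 - y) + t * (1 - z)) * (r * (r + 1)) ≤ 1 / 2 * (r * (r + 1)) :=
      mul_le_mul_of_nonneg_right (by linarith) (by positivity)
    linarith
  have hst' : 0 ≤ (s - 1) * (t - 1) := mul_nonneg (by linarith) (by linarith)
  have hrr : 0 < (r - 9) * r := mul_pos (by linarith) hr0
  linarith

theorem IsPerron.false_of_doubleStar (hx : IsPerron G u x r) (hr : 9 < r)
    (hfar : far G u = ∅) {b c : V} (hbc : (link G u).Adj b c) (hb : 2 ≤ (link G u).degree b)
    (hc : 2 ≤ (link G u).degree c)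
    (hz : ∀ z, z ≠ b → z ≠ c → (link G u).degree z < 2 ∧
      ∀ y, (link G u).Adj z y → y = b ∨ y = c)
    (hle : ((link G u).degree b - 1) * (1 - x b) + ((link G u).degree c - 1) * (1 - x c) +
      ∑ v ∈ lonely G u, x v ≤ 1 / 2) : False := by
  have hsum := sum_near_doubleStar hbc hz
  have hI := hx.sum_lonely hr hfar
  have hlon : ∀ v ∈ lonely G u, (link G u).degree v = 0 := fun v hv => (mem_lonely.1 hv).2
  set B := ((link G u).neighborFinset b).erase c with hB
  set C := ((link G u).neighborFinset c).erase b with hC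
  have hleafB : ∀ v ∈ B, (link G u).degree v = 1 := fun v hv => by
    simp only [hB, mem_erase, SimpleGraph.mem_neighborFinset] at hv
    exact degree_eq_one_of_adj (hz v hv.2.ne.symm hv.1).1 hv.2.symm
  have hleafC : ∀ v ∈ C, (link G u).degree v = 1 := fun v hv => by
    simp only [hC, mem_erase, SimpleGraph.mem_neighborFinset] at hv
    exact degree_eq_one_of_adj (hz v hv.1 hv.2.ne.symm).1 hv.2.symm
  have hcB : c ∈ (link G u).neighborFinset b := by simpa using hbc
  have hbC : b ∈ (link G u).neighborFinset c := by simpa using hbc.symm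
  have hcardB : (#B : ℝ) = (link G u).degree b - 1 := by
    have : #B + 1 = (link G u).degree b := by
      rw [hB, card_erase_add_one hcB, SimpleGraph.card_neighborFinset_eq_degree]
    rw [← this]
    push_cast
    ring
  have hcardC : (#C : ℝ) = (link G u).degree c - 1 := by
    have : #C + 1 = (link G u).degree c := by
      rw [hC, card_erase_add_one hbC, SimpleGraph.card_neighborFinset_eq_degree]
    rw [← this]
    push_cast
    ring
  have hlow : ∀ s : Finset V, (∀ v ∈ s, G.Adj u v) → (#s : ℝ) ≤ r * ∑ v ∈ s, x v := by
    intro s hs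
    rw [mul_sum, card_eq_sum_ones, Nat.cast_sum]
    refine sum_le_sum fun v hv => ?_
    rw [hx.eig_near (hs v hv), hfar]
    have : 0 ≤ ∑ w ∈ (link G u).neighborFinset v, x w := sum_nonneg fun w _ => hx.nonneg w
    simpa using this
  have hlowB := hlow B fun v hv => by
    simp only [hB, mem_erase, SimpleGraph.mem_neighborFinset] at hv
    exact hv.2.2.2
  have hlowC := hlow C fun v hv => by
    simp only [hC, mem_erase, SimpleGraph.mem_neighborFinset] at hv
    exact hv.2.2.2
  have hcard : (#(near G u) : ℝ) = 2 + #B + #C + #(lonely G u) := by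
    have := hsum (fun _ => 1)
    simp only [sum_const, nsmul_eq_mul, mul_one] at this
    linarith
  have hdegx : ∑ v ∈ near G u, ((link G u).degree v : ℝ) * x v =
      (link G u).degree b * x b + (link G u).degree c * x c + ∑ v ∈ B, x v + ∑ v ∈ C, x v := by
    rw [hsum, sum_congr rfl fun v hv => by rw [hleafB v hv],
      sum_congr (s₁ := C) rfl fun v hv => by rw [hleafC v hv],
      sum_congr (s₁ := lonely G u) rfl fun v hv => by rw [hlon v hv]]
    simp
  have hxb := hx.eig_near hbc.2.1
  have hxc := hx.eig_near hbc.2.2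
  have hsq := hx.sq_eq
  have hxs := hx.sum_near
  rw [hfar] at hxb hxc hsq
  rw [hsum] at hxs
  rw [← sum_erase_add _ _ hcB] at hxb
  rw [← sum_erase_add _ _ hbC] at hxc
  rw [hdegx, hcard] at hsq
  simp only [sum_empty, filter_empty, add_zero, ← hB, ← hC] at hxb hxc hsq
  rw [hI] at hle hxs
  have hxb1 := hx.le_one b
  have hxc1 := hx.le_one c
  have hb' : (2 : ℝ) ≤ (link G u).degree b := by exact_mod_cast hb
  have hc' : (2 : ℝ) ≤ (link G u).degree c := by exact_mod_cast hc
  have hdb : ((link G u).degree b : ℝ) = #B + 1 := by linarith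
  have hdc : ((link G u).degree c : ℝ) = #C + 1 := by linarith
  rw [hdb] at hb' hle hsq
  rw [hdc] at hc' hle hsq
  have hk0 : (0 : ℝ) ≤ #(lonely G u) := Nat.cast_nonneg _
  exact doubleStar_arith hr hk0 (by linarith) (by linarith) hxb1 hxc1 hlowB hlowC
    (by linarith) (by linarith) hxs (by linarith) (by linarith)

/-- A graph without isolated vertices and without `C_5^+`, of even size `m`, whose spectral radius
`r > 9` satisfies `m - 3 / 2 ≤ r ^ 2 - r`, is an `S_{n,2}^-`. -/
theorem IsPerron.exists_isSplitMinus (hx : IsPerron G u x r) (hfree : (cyclePlus 5).Free G)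
    (hr : 9 < r) (hiso : ∀ v : V, ¬ G.IsIsolated v) (heven : Even G.edgeSet.ncard)
    (hm : (G.edgeSet.ncard : ℝ) - 3 / 2 ≤ r ^ 2 - r) :
    ∃ b i, IsSplitMinus G u b i ∧ 2 * Fintype.card V = G.edgeSet.ncard + 4 := by
  have hH := pathFiveFree_link (u := u) hfree
  have hdeep := hx.not_isDeep hfree hr hm
  have hN := mem_near_of_degree_link_ne_zero (G := G) (u := u)
  have hkey := hx.sq_sub_eq_sub_farLoss
  have hQ : 0 ≤ ∑ w ∈ far G u, farLoss G u x w := sum_nonneg fun w _ => hx.farLoss_nonneg w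
  have hiso_le := fun T hT => sum_isolated_le hH hdeep hN hx.nonneg hx.le_one (T := T) hT
  rcases star_or_doubleStar hH hdeep hN hx.nonneg hx.le_one (by linarith)
    (by rw [hx.sum_near]; linarith) with ⟨b, hb, hk, hz⟩ | ⟨b, c, hbc, hb, hc, hkb, hkc, hz⟩
  · have h1 := hiso_le {b} (by simpa using hb)
    rw [sum_singleton, charge_of_two_le_degree hb, hk, Nat.cast_zero, zero_div, sub_zero] at h1
    have h2 : 0 ≤ ((link G u).degree b - 1 : ℝ) * (1 - x b) := by
      have : (2 : ℝ) ≤ (link G u).degree b := by exact_mod_cast hb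
      exact mul_nonneg (by linarith) (by linarith [hx.le_one b])
    have hfar := hx.far_eq_empty hfree hr hiso b (fun a ha => ?_) (by linarith)
    · exact ⟨b, hx.isSplitMinus_of_star hr hfar heven hb hz (by rw [lonely]; linarith)⟩
    · by_cases hab : a = b
      · exact Or.inl hab
      obtain ⟨y, hy⟩ := ((link G u).degree_pos_iff_exists_adj a).1 (Nat.pos_of_ne_zero ha)
      have hyb := (hz a hab).2 y hy
      subst hyb
      obtain ⟨c', hc', hne⟩ := exists_adj_of_two_le_degree hb a
      exact Or.inr ⟨y, c', hy, hc', hne.symm⟩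
  · have h1 := hiso_le {b, c} (by simp [hb, hc])
    rw [sum_pair hbc.ne, charge_of_two_le_degree hb, charge_of_two_le_degree hc, hkb, hkc,
      Nat.cast_one] at h1
    have h2 : 0 ≤ ((link G u).degree b - 1 : ℝ) * (1 - x b) := by
      have : (2 : ℝ) ≤ (link G u).degree b := by exact_mod_cast hb
      exact mul_nonneg (by linarith) (by linarith [hx.le_one b])
    have h3 : 0 ≤ ((link G u).degree c - 1 : ℝ) * (1 - x c) := by
      have : (2 : ℝ) ≤ (link G u).degree c := by exact_mod_cast hc
      exact mul_nonneg (by linarith) (by linarith [hx.le_one c])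
    have hfar := hx.far_eq_empty hfree hr hiso b (fun a ha => ?_) (by linarith)
    · exact (hx.false_of_doubleStar hr hfar hbc hb hc hz (by rw [lonely]; linarith)).elim
    · obtain ⟨y, hy⟩ := ((link G u).degree_pos_iff_exists_adj a).1 (Nat.pos_of_ne_zero ha)
      by_cases hac : a = c
      · obtain ⟨c', hc', hne⟩ := exists_adj_of_two_le_degree hb a
        exact Or.inr ⟨b, c', hac ▸ hbc.symm, hc', hne.symm⟩
      by_cases hab : a = b
      · exact Or.inl hab
      have hy2 : 2 ≤ (link G u).degree y := by
        rcases (hz a hab hac).2 y hy with rfl | rfl <;> assumption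
      obtain ⟨c', hc', hne⟩ := exists_adj_of_two_le_degree hy2 a
      exact Or.inr ⟨y, c', hy, hc', hne.symm⟩

end Final

end SpectralTuran

/-! ### The main theorem -/

theorem theorem1p6 {V : Type*} [Fintype V] (G : SimpleGraph V) (m : ℕ)
    (hm : 74 ≤ m) (hm_even : Even m)
    (hsize : G.edgeSet.ncard = m)
    (hisolated : ∀ v : V, ¬ G.IsIsolated v)
    (hfree : (SpectralTuran.cyclePlus 5).Free G) :
    SpectralTuran.rho G ≤ SpectralTuran.rho (SpectralTuran.splitGraphMinus ((m + 4) / 2)) ∧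
      (SpectralTuran.rho G = SpectralTuran.rho (SpectralTuran.splitGraphMinus ((m + 4) / 2)) ↔
        Nonempty (G ≃g SpectralTuran.splitGraphMinus ((m + 4) / 2))) := by
  obtain ⟨d, rfl⟩ : ∃ d, m = 2 * d + 2 := by
    obtain ⟨t, ht⟩ := hm_even
    exact ⟨t - 1, by omega⟩
  have hn : (2 * d + 2 + 4) / 2 = d + 3 := by omega
  rw [hn]
  have hd : (36 : ℝ) ≤ d := by exact_mod_cast (by omega : 36 ≤ d)
  have hsplit := SpectralTuran.isSplitMinus_splitGraphMinus d
  have hV : Nonempty V := by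
    by_contra h
    rw [not_nonempty_iff] at h
    have : G.edgeSet = ∅ := Set.eq_empty_of_isEmpty _
    rw [this, Set.ncard_empty] at hsize
    omega
  -- c is the larger root of c² - c = m - 3/2. It exceeds 9 because 8 · 36 + 3 = 291 > 17²; this is
  -- where m ≥ 74 enters.
  obtain ⟨c, hc9, hc⟩ : ∃ c : ℝ, 9 < c ∧ c ^ 2 - c = 2 * d + 1 / 2 := by
    refine ⟨(1 + √(8 * d + 3)) / 2, ?_, ?_⟩
    · have : (17 : ℝ) < √(8 * d + 3) := Real.lt_sqrt_of_sq_lt (by linarith)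
      linarith
    · have := Real.sq_sqrt (show (0 : ℝ) ≤ 8 * d + 3 by linarith)
      linarith
  have hcrho : c ≤ SpectralTuran.rho (SpectralTuran.splitGraphMinus (d + 3)) :=
    hsplit.le_rho (by simp) (by linarith) hc
  -- Reaching the extremal radius already forces isomorphism, so both the bound and the equality
  -- case follow from this implication.
  have key : SpectralTuran.rho (SpectralTuran.splitGraphMinus (d + 3)) ≤ SpectralTuran.rho G →
      Nonempty (G ≃g SpectralTuran.splitGraphMinus (d + 3)) := by
    intro hle
    obtain ⟨x, u, h0, h1, hu, heig⟩ := SpectralTuran.exists_perron_vector G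
    have hx : SpectralTuran.IsPerron G u x (SpectralTuran.rho G) := ⟨h0, h1, hu, heig⟩
    have hcr : c ≤ SpectralTuran.rho G := hcrho.trans hle
    obtain ⟨b, i, hbi, hcard⟩ := hx.exists_isSplitMinus hfree (by linarith) hisolated
      (by rw [hsize]; exact hm_even) (by
        rw [hsize]
        push_cast
        nlinarith)
    refine hbi.nonempty_iso hsplit ?_
    rw [Fintype.card_fin]
    omega
  have hiso : Nonempty (G ≃g SpectralTuran.splitGraphMinus (d + 3)) →
      SpectralTuran.rho G = SpectralTuran.rho (SpectralTuran.splitGraphMinus (d + 3)) :=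
    fun ⟨e⟩ => SpectralTuran.rho_eq_of_iso e
  refine ⟨?_, fun h => key h.ge, hiso⟩
  by_contra! h
  exact h.ne' (hiso (key h.le))
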